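/- Let $\mathbb F_q$ be a fixed finite field with $q$ elements. For $F\in\mathbb F_q[T]$ put $|F|=q^{\deg F}$, with $|0|=0$. For $h\ge 0$ an integer let $I(F,h)=\{G\in\mathbb F_q[T]:|F-G|<q^h\}$. For $Q\ne 0$ let $\phi(Q)=\#\{A\in\mathbb F_q[T] : |A|<|Q|,\ (A,Q)=1\}$ and define the fifth centered moment of reduced residues \[m_5(Q;h)=\sum_{|F|<|Q|}\Bigl(\#\{G\in I(F,h):(G,Q)=1\}-\frac{q^h\phi(Q)}{|Q|}\Bigr)^5 .\] (a) For every $\varepsilon>0$ there is a constant $C>0$, depending only on $\varepsilon$ and $\mathbb F_q$, such that for every squarefree $Q\in\mathbb F_q[T]$ and every integer $h\ge 0$, \[|m_5(Q;h)|\le C\left(|Q|\,(q^h)^{2+\varepsilon}\left(\frac{|Q|}{\phi(Q)}\right)^{-4}+|Q|\,q^{2h}\left(\frac{|Q|}{\phi(Q)}\right)^{27}\right).\] (b) For every $\varepsilon>0$ there is a constant $C>0$, depending only on $\varepsilon$ and $\mathbb F_q$, such that for every integer $h\ge 0$, if $Q$ is the product of all monic irreducible $P\in\mathbb F_q[T]$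 with $|P|\le q^{2h}$, then \[|m_5(Q;h)|\le C\,|Q|\,(q^h)^{2+\varepsilon}.\] -/

import Mathlib

open Polynomial

noncomputable section

namespace FFMoment

variable {K : Type*} [Field K] [Fintype K]

open Classical in
/-- The norm `|F| = q ^ deg F` on `𝔽_q[T]`, with `|0| = 0`. -/
def nrm (F : K[X]) : ℝ := if F = 0 then 0 else (Fintype.card K : ℝ) ^ F.natDegree

theorem finite_nrm_le (x : ℝ) : {A : K[X] | nrm A ≤ x}.Finite := by
  obtain ⟨n, hn⟩ := pow_unbounded_of_one_lt x
    (show (1 : ℝ) < (Fintype.card K : ℝ) by exact_mod_cast Fintype.one_lt_card)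
  have hfin : ((Polynomial.degreeLT K n : Submodule K K[X]) : Set K[X]).Finite := by
    have : Finite (Polynomial.degreeLT K n) :=
      Finite.of_equiv _ (Polynomial.degreeLTEquiv K n).toEquiv.symm
    exact Set.toFinite _
  refine hfin.subset ?_
  intro A hA
  simp only [Set.mem_ofPred_eq, nrm] at hA
  rw [SetLike.mem_coe, Polynomial.mem_degreeLT]
  by_cases h0 : A = 0
  · subst h0
    simp
  · rw [if_neg h0] at hA
    have h1 : (Fintype.card K : ℝ) ^ A.natDegree < (Fintype.card K : ℝ) ^ n := lt_of_le_of_lt hA hn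
    have h2 := (pow_lt_pow_iff_right₀
      (show (1 : ℝ) < (Fintype.card K : ℝ) by exact_mod_cast Fintype.one_lt_card)).1 h1
    rwa [Polynomial.degree_eq_natDegree h0, Nat.cast_lt]

theorem finite_nrm_lt (x : ℝ) : {A : K[X] | nrm A < x}.Finite :=
  (finite_nrm_le x).subset (by
    intro A hA
    rw [Set.mem_ofPred_eq] at hA ⊢
    exact le_of_lt hA)

/-- The interval `I(F, h) = {G : |F - G| < q ^ h}`. -/
def interval (F : K[X]) (h : ℕ) : Set K[X] := {G | nrm (F - G) < (Fintype.card K : ℝ) ^ h}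

theorem finite_interval (F : K[X]) (h : ℕ) : (interval F h).Finite :=
  (finite_nrm_lt ((Fintype.card K : ℝ) ^ h)).preimage (sub_right_injective (b := F)).injOn

/-- The canonical representatives `|A| < |Q|` of the residue classes modulo `Q ≠ 0`
(for a nonzero constant `Q` this is `{0}`). -/
def residues (Q : K[X]) : Finset K[X] := (finite_nrm_lt (nrm Q)).toFinset

open Classical in
/-- Euler's function: the number of reduced residue classes modulo `Q`. -/
def phi (Q : K[X]) : ℕ := ((residues Q).filter fun A => IsCoprime A Q).card

open Classical in
/-- The number of `G ∈ I(F, h)` with `(G, Q) = 1`. -/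
def coprimeCount (Q F : K[X]) (h : ℕ) : ℕ :=
  ((finite_interval F h).toFinset.filter fun G => IsCoprime G Q).card

/-- The `k`-th centered moment `m_k(Q; h)` of reduced residues modulo `Q` in intervals. -/
def moment (k : ℕ) (Q : K[X]) (h : ℕ) : ℝ :=
  ∑ F ∈ residues Q,
    ((coprimeCount Q F h : ℝ) - (Fintype.card K : ℝ) ^ h * (phi Q : ℝ) / nrm Q) ^ k

theorem finite_irred (x : ℝ) : {P : K[X] | P.Monic ∧ Irreducible P ∧ nrm P ≤ x}.Finite :=
  (finite_nrm_le x).subset (by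
    intro P hP
    rw [Set.mem_ofPred_eq] at hP ⊢
    exact hP.2.2)

variable (K) in
/-- The product of all monic irreducible `P` with `|P| ≤ x`. -/
def irredProduct (x : ℝ) : K[X] := ∏ P ∈ (finite_irred (K := K) x).toFinset, P

end FFMoment

end

/-!
Write `H = q ^ h`. Up to a unit, `Q` is the product of a finite set `PP` of monic irreducibles. The
indicator function of the polynomials prime to `Q` has a Fourier expansion whose coefficient at a
fraction with reduced denominator `D` is at most `1 / |D|` in absolute value, and the sum of an
additive character over an interval of length `H` vanishes unless its frequency has norm less than
`1 / H`. Hence `|m₅(Q; h)| ≤ |Q| H ^ 5 T₅` (`abs_moment_five_le`), where `T₅` is the sum of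
`1 / (|D₁| ⋯ |D₅|)` over quintuples of nonzero fractions of norm less than `1 / H` with sum zero,
and `Dᵢ` is the denominator of the `i`-th fraction. The heart of the matter is
`T₅ ≪ H ^ (-3 + ε) Z ^ 26` with `Z = |Q| / φ(Q)` (`exists_quintupleSum_le`).

For two fractions let `C` be the part of the common denominator that cancels in their sum, `s` the
part that does not cancel, and `E = |C| ^ 2 |s|`; `link` is the degree of `E`. Two facts carry the
argument.

* The pairs of fractions with a given sum `β` of denominator `D`, weighted by
  `min(E, H) / (|D₁| |D₂|)`, have total weight `≪ H ^ ε Z ^ k` times `c ^ ω(D) / |D|`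
  (`exists_pairSum_le`). Indeed, once the way `D` is split between the two denominators and the
  degree of `C` are fixed, there are at most `max(1, E / H)` pairs (`card_repClass_wt_eq_le`): a
  determinant formed from two representations is divisible by a large modulus, and it determines
  one representation from the other.
* A prime in one of the denominators of fractions with sum zero divides two others, or cancels
  against the only other one that it divides (`two_mul_wt_supp_le`). So at each fraction of
  denominator `D₁` the product of the `E` over the other fractions is at least
  `|D₁| ^ 2 > H ^ 2`. In a triple, one pair therefore has `E ≥ H`. In a quintuple, the complete
  graph on five vertices splits into five matchings of two edges, and one of them has
  `E E' ≥ H` (`exists_matching`).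

For triples, replacing the pair with `E ≥ H` by its sum gives
`T₃ ≪ H ^ (-2 + ε) Z ^ k` (`exists_tripleSum_le`), also with divisor-like weights. For quintuples
with no zero sum in the chosen matching, replacing both pairs by their sums gains `1 / H` and leaves
a weighted triple sum; if a pair has sum zero, the sum factors into a sum over one fraction, of size
`Z / H`, and `T₃`. The exponent of `Z` adds up to `24 + 2 = 26`.

Since `26 < 27`, part (a) follows by comparing `Z` with a small power of `H`; part (b) follows from
`Z ≪ h ^ 2 + 1` for the primes of degree at most `2 h`, that is, from the bound `q ^ d / d` for the
number of monic irreducibles of degree `d`.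
-/

noncomputable section

namespace FFMoment

set_option linter.unusedSectionVars false

open scoped Classical

variable {K : Type*} [Field K] [Fintype K]

/-! ### Polynomials of bounded degree, denominators and arcs -/

theorem finite_degree_lt (n : ℕ) : {A : K[X] | A.degree < n}.Finite := by
  have : Finite (Polynomial.degreeLT K n) :=
    Finite.of_equiv _ (Polynomial.degreeLTEquiv K n).toEquiv.symm
  have hfin : ((Polynomial.degreeLT K n : Submodule K K[X]) : Set K[X]).Finite := Set.toFinite _
  exact hfin.subset fun A hA => Polynomial.mem_degreeLT.2 hA

variable (K) in
/-- The finite set of polynomials of degree less than `n`, including `0`. -/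
def polyLT (n : ℕ) : Finset K[X] := (finite_degree_lt (K := K) n).toFinset

theorem mem_polyLT {n : ℕ} {A : K[X]} : A ∈ polyLT K n ↔ A.degree < n := by
  simp [polyLT]

theorem zero_mem_polyLT (n : ℕ) : (0 : K[X]) ∈ polyLT K n := by
  simp [mem_polyLT]

theorem mem_polyLT_iff {n : ℕ} {A : K[X]} (hA : A ≠ 0) : A ∈ polyLT K n ↔ A.natDegree < n := by
  rw [mem_polyLT, Polynomial.natDegree_lt_iff_degree_lt hA]

theorem sub_mem_polyLT {n : ℕ} {A B : K[X]} (hA : A ∈ polyLT K n) (hB : B ∈ polyLT K n) :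
    A - B ∈ polyLT K n := by
  rw [mem_polyLT] at *
  exact lt_of_le_of_lt (degree_sub_le A B) (max_lt hA hB)

theorem add_mem_polyLT {n : ℕ} {A B : K[X]} (hA : A ∈ polyLT K n) (hB : B ∈ polyLT K n) :
    A + B ∈ polyLT K n := by
  rw [mem_polyLT] at *
  exact lt_of_le_of_lt (degree_add_le A B) (max_lt hA hB)

theorem neg_mem_polyLT {n : ℕ} {A : K[X]} (hA : A ∈ polyLT K n) : -A ∈ polyLT K n := by
  rw [mem_polyLT] at *
  rwa [degree_neg]

theorem card_polyLT (n : ℕ) : (polyLT K n).card = Fintype.card K ^ n := by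
  have e : {A : K[X] // A ∈ polyLT K n} ≃ (Fin n → K) :=
    (Equiv.subtypeEquivRight (fun A => by rw [mem_polyLT, ← Polynomial.mem_degreeLT])).trans
      (Polynomial.degreeLTEquiv K n).toEquiv
  have := Fintype.card_congr e
  simpa using this

theorem polyLT_mono {m n : ℕ} (h : m ≤ n) : polyLT K m ⊆ polyLT K n := by
  intro A hA
  rw [mem_polyLT] at *
  exact hA.trans_le (by exact_mod_cast h)

/-- Polynomials of degree less than `n` in one class modulo `W` number at most
`q ^ (n - deg W)`; the subtraction is truncated, since a short range holds at most one. -/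
theorem card_le_of_sub_dvd {n : ℕ} {W : K[X]} (hW : W ≠ 0) {S : Finset K[X]}
    (hS : S ⊆ polyLT K n) (hd : ∀ A ∈ S, ∀ B ∈ S, W ∣ A - B) :
    S.card ≤ Fintype.card K ^ (n - W.natDegree) := by
  rcases S.eq_empty_or_nonempty with rfl | ⟨B, hB⟩
  · simp
  rw [← card_polyLT]
  have key : ∀ A ∈ S, W * ((A - B) / W) = A - B := fun A hA =>
    EuclideanDomain.mul_div_cancel' hW (hd A hA B hB)
  refine Finset.card_le_card_of_injOn (fun A => (A - B) / W) ?_ ?_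
  · intro A hA
    by_cases h0 : (A - B) / W = 0
    · simp only [h0]
      exact zero_mem_polyLT _
    · refine (mem_polyLT_iff h0).2 ?_
      have h1 := sub_mem_polyLT (hS hA) (hS hB)
      rw [← key A hA, mem_polyLT_iff (mul_ne_zero hW h0), natDegree_mul hW h0] at h1
      omega
  · intro A hA A' hA' h
    have h1 := key A hA
    have h2 := key A' hA'
    simp only at h
    rw [h, h2] at h1
    exact (sub_left_inj.1 h1).symm

/-- A finite set of monic irreducible polynomials. -/
def IsPrimeSet (PP : Finset K[X]) : Prop := ∀ p ∈ PP, p.Monic ∧ Irreducible p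

theorem IsPrimeSet.mono {D PP : Finset K[X]} (hP : IsPrimeSet PP) (h : D ⊆ PP) : IsPrimeSet D :=
  fun p hp => hP p (h hp)

/-- The total degree of a finite set of polynomials. -/
def wt (D : Finset K[X]) : ℕ := ∑ p ∈ D, p.natDegree

theorem wt_mono {D D' : Finset K[X]} (h : D ⊆ D') : wt D ≤ wt D' :=
  Finset.sum_le_sum_of_subset h

theorem wt_sdiff_add {D D' : Finset K[X]} (h : D ⊆ D') : wt (D' \ D) + wt D = wt D' :=
  Finset.sum_sdiff h

theorem wt_union {D D' : Finset K[X]} (h : Disjoint D D') : wt (D ∪ D') = wt D + wt D' :=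
  Finset.sum_union h

theorem IsPrimeSet.monic_prod {D : Finset K[X]} (hD : IsPrimeSet D) : (∏ p ∈ D, p).Monic :=
  monic_prod_of_monic _ _ fun p hp => (hD p hp).1

theorem IsPrimeSet.natDegree_prod {D : Finset K[X]} (hD : IsPrimeSet D) :
    (∏ p ∈ D, p).natDegree = wt D :=
  natDegree_prod_of_monic _ _ fun p hp => (hD p hp).1

theorem IsPrimeSet.eq_of_dvd {D : Finset K[X]} (hD : IsPrimeSet D) {p r : K[X]} (hp : p ∈ D)
    (hr : r ∈ D) (h : p ∣ r) : p = r :=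
  eq_of_monic_of_associated (hD p hp).1 (hD r hr).1 ((hD p hp).2.associated_of_dvd (hD r hr).2 h)

theorem IsPrimeSet.isCoprime {D : Finset K[X]} (hD : IsPrimeSet D) {p r : K[X]} (hp : p ∈ D)
    (hr : r ∈ D) (h : p ≠ r) : IsCoprime p r :=
  ((hD p hp).2.coprime_iff_not_dvd).2 fun hd => h (hD.eq_of_dvd hp hr hd)

theorem IsPrimeSet.prod_dvd_iff {D : Finset K[X]} (hD : IsPrimeSet D) {B : K[X]} :
    (∏ p ∈ D, p) ∣ B ↔ ∀ p ∈ D, p ∣ B := by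
  refine ⟨fun h p hp => (Finset.dvd_prod_of_mem _ hp).trans h, fun h => ?_⟩
  exact Finset.prod_dvd_of_coprime (fun p hp r hr hpr => hD.isCoprime hp hr hpr) h

theorem IsPrimeSet.dvd_prod_iff {PP D : Finset K[X]} (hP : IsPrimeSet PP) (hD : D ⊆ PP) {p : K[X]}
    (hp : p ∈ PP) : p ∣ (∏ r ∈ D, r) ↔ p ∈ D := by
  refine ⟨fun h => ?_, fun h => Finset.dvd_prod_of_mem _ h⟩
  obtain ⟨r, hr, hpr⟩ := ((hP p hp).2.prime.dvd_finsetProd_iff _).1 h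
  rwa [hP.eq_of_dvd hp (hD hr) hpr]

/-- The primes in the reduced denominator of `B / ∏ p ∈ PP, p`. -/
def supp (PP : Finset K[X]) (B : K[X]) : Finset K[X] := PP.filter fun p => ¬ p ∣ B

theorem mem_supp {PP : Finset K[X]} {B p : K[X]} : p ∈ supp PP B ↔ p ∈ PP ∧ ¬ p ∣ B := by
  simp [supp]

theorem supp_subset (PP : Finset K[X]) (B : K[X]) : supp PP B ⊆ PP := Finset.filter_subset _ _

theorem supp_neg (PP : Finset K[X]) (B : K[X]) : supp PP (-B) = supp PP B := by
  simp [supp]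

/-- The numerators of the nonzero fractions with denominator `∏ p ∈ PP, p` and norm less than
`q ^ (-h)`. -/
def arc (PP : Finset K[X]) (h : ℕ) : Finset K[X] := (polyLT K (wt PP - h)).erase 0

theorem mem_arc {PP : Finset K[X]} {h : ℕ} {B : K[X]} :
    B ∈ arc PP h ↔ B ≠ 0 ∧ B ∈ polyLT K (wt PP - h) := by
  simp [arc]

theorem neg_mem_arc {PP : Finset K[X]} {h : ℕ} {B : K[X]} (hB : B ∈ arc PP h) :
    -B ∈ arc PP h := by
  rw [mem_arc] at *
  exact ⟨neg_ne_zero.2 hB.1, neg_mem_polyLT hB.2⟩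

theorem add_mem_arc {PP : Finset K[X]} {h : ℕ} {A B : K[X]} (hA : A ∈ arc PP h)
    (hB : B ∈ arc PP h) (h0 : A + B ≠ 0) : A + B ∈ arc PP h := by
  rw [mem_arc] at *
  exact ⟨h0, add_mem_polyLT hA.2 hB.2⟩

theorem lt_wt_supp {PP : Finset K[X]} (hP : IsPrimeSet PP) {h : ℕ} {B : K[X]}
    (hB : B ∈ arc PP h) : h < wt (supp PP B) := by
  rw [mem_arc] at hB
  have h1 := (mem_polyLT_iff hB.1).1 hB.2
  have hs := hP.mono (Finset.sdiff_subset (s := PP) (t := supp PP B))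
  have h2 : (∏ p ∈ PP \ supp PP B, p) ∣ B := by
    rw [hs.prod_dvd_iff]
    intro p hp
    rw [Finset.mem_sdiff, mem_supp] at hp
    by_contra hc
    exact hp.2 ⟨hp.1, hc⟩
  have h3 := natDegree_le_of_dvd h2 hB.1
  rw [hs.natDegree_prod] at h3
  have h4 := wt_sdiff_add (supp_subset PP B)
  omega

/-- For each prime in both denominators of `B` and `B'`, twice its degree if it cancels in the
sum of the two fractions, and its degree otherwise. -/
def link (PP : Finset K[X]) (B B' : K[X]) : ℕ :=
  ∑ p ∈ PP, if ¬ p ∣ B ∧ ¬ p ∣ B' then (if p ∣ B + B' then 2 else 1) * p.natDegree else 0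

theorem link_comm (PP : Finset K[X]) (B B' : K[X]) : link PP B B' = link PP B' B := by
  unfold link
  refine Finset.sum_congr rfl fun p _ => ?_
  simp only [add_comm B B', and_comm (a := ¬ p ∣ B)]

/-- If fractions sum to zero, each prime in the denominator of one of them either lies in at least
two of the other denominators or cancels against the only other one. -/
theorem two_mul_wt_supp_le {PP : Finset K[X]} {ι : Type*} (s : Finset ι)
    (a : K[X]) (B : ι → K[X]) (h0 : a + ∑ j ∈ s, B j = 0) :
    2 * wt (supp PP a) ≤ ∑ j ∈ s, link PP a (B j) := by
  unfold link
  rw [Finset.sum_comm, wt, Finset.mul_sum, supp, Finset.sum_filter]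
  refine Finset.sum_le_sum fun p hp => ?_
  by_cases hpa : p ∣ a
  · simp [hpa]
  rw [if_pos hpa]
  set J := s.filter fun j => ¬ p ∣ B j with hJ
  have hrest : p ∣ ∑ j ∈ s.filter (fun j => p ∣ B j), B j :=
    Finset.dvd_sum fun j hj => (Finset.mem_filter.1 hj).2
  have hsum : a + ∑ j ∈ J, B j + ∑ j ∈ s.filter (fun j => p ∣ B j), B j = 0 := by
    rw [add_assoc, add_comm (∑ j ∈ J, B j), hJ, Finset.sum_filter_add_sum_filter_not, h0]
  have hdvd : p ∣ a + ∑ j ∈ J, B j := by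
    rw [eq_neg_of_add_eq_zero_left hsum]
    exact hrest.neg_right
  have hJs : ∑ j ∈ J, (if p ∣ a + B j then 2 else 1) * p.natDegree ≤
      ∑ j ∈ s, if ¬ p ∣ a ∧ ¬ p ∣ B j then (if p ∣ a + B j then 2 else 1) * p.natDegree else 0 := by
    rw [hJ, Finset.sum_filter]
    refine Finset.sum_le_sum fun j _ => ?_
    simp [hpa]
  refine le_trans ?_ hJs
  rw [← Finset.sum_mul]
  refine Nat.mul_le_mul_right _ ?_
  rcases Nat.lt_or_ge J.card 2 with hlt | hge
  · have hne : J.Nonempty := by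
      rw [Finset.nonempty_iff_ne_empty]
      intro he
      rw [he] at hdvd
      simp [hpa] at hdvd
    obtain ⟨j, hj⟩ := Finset.card_eq_one.1 (show J.card = 1 by
      have := hne.card_pos
      omega)
    rw [hj] at hdvd ⊢
    simp only [Finset.sum_singleton] at hdvd ⊢
    simp [hdvd]
  · refine hge.trans ?_
    rw [Finset.card_eq_sum_ones]
    refine Finset.sum_le_sum fun j _ => ?_
    split_ifs <;> norm_num

/-- The weight `k ^ #D / |D|`, where `D` is the set of primes in the denominator of `B`. -/
def cf (PP : Finset K[X]) (k : ℕ) (B : K[X]) : ℝ :=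
  (k : ℝ) ^ (supp PP B).card / (Fintype.card K : ℝ) ^ wt (supp PP B)

/-- The Euler product `∏ (1 - 1 / |p|)⁻¹`, which is `|Q| / φ(Q)` for `Q = ∏ p ∈ PP, p`. -/
def eulerZ (PP : Finset K[X]) : ℝ := ∏ p ∈ PP, (1 - ((Fintype.card K : ℝ) ^ p.natDegree)⁻¹)⁻¹

theorem one_lt_q : (1 : ℝ) < (Fintype.card K : ℝ) := by exact_mod_cast Fintype.one_lt_card

theorem q_pos : (0 : ℝ) < (Fintype.card K : ℝ) := zero_lt_one.trans one_lt_q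

theorem cf_nonneg (PP : Finset K[X]) (k : ℕ) (B : K[X]) : 0 ≤ cf PP k B := by
  unfold cf; positivity

theorem cf_neg (PP : Finset K[X]) (k : ℕ) (B : K[X]) : cf PP k (-B) = cf PP k B := by
  simp [cf, supp_neg]

theorem inv_q_pow_le {p : K[X]} (hp : Irreducible p) :
    ((Fintype.card K : ℝ) ^ p.natDegree)⁻¹ ≤ 1 / 2 := by
  have h2 : (2 : ℝ) ≤ (Fintype.card K : ℝ) ^ p.natDegree := by
    have h1 : (2 : ℝ) ≤ (Fintype.card K : ℝ) := by exact_mod_cast Fintype.one_lt_card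
    exact h1.trans (le_self_pow₀ one_lt_q.le hp.natDegree_pos.ne')
  rw [one_div]
  exact inv_anti₀ (by norm_num) h2

theorem one_le_eulerZ {PP : Finset K[X]} (hP : IsPrimeSet PP) : 1 ≤ eulerZ PP := by
  unfold eulerZ
  refine Finset.one_le_prod fun p hp => ?_
  have h1 := inv_q_pow_le (hP p hp).2
  have h2 : 0 < ((Fintype.card K : ℝ) ^ p.natDegree)⁻¹ := inv_pos.2 (pow_pos q_pos _)
  exact (one_le_inv₀ (by linarith)).2 (by linarith)

/-- A sum over the squarefree divisors of `∏ p ∈ PP, p`, bounded by a power of the Euler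
product. -/
theorem sum_powerset_le {PP : Finset K[X]} (hP : IsPrimeSet PP) (m : ℕ) :
    ∑ D ∈ PP.powerset, (m : ℝ) ^ D.card / (Fintype.card K : ℝ) ^ wt D ≤ eulerZ PP ^ m := by
  have h1 : ∑ D ∈ PP.powerset, (m : ℝ) ^ D.card / (Fintype.card K : ℝ) ^ wt D =
      ∏ p ∈ PP, (1 + m * ((Fintype.card K : ℝ) ^ p.natDegree)⁻¹) := by
    rw [Finset.prod_one_add]
    refine Finset.sum_congr rfl fun D _ => ?_
    rw [Finset.prod_mul_distrib, Finset.prod_const, Finset.prod_inv_distrib, wt,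
      Finset.prod_pow_eq_pow_sum, div_eq_mul_inv]
  rw [h1, eulerZ, ← Finset.prod_pow]
  refine Finset.prod_le_prod (fun p _ => by positivity) fun p hp => ?_
  have h2 := inv_q_pow_le (hP p hp).2
  have h3 : 0 < ((Fintype.card K : ℝ) ^ p.natDegree)⁻¹ := inv_pos.2 (pow_pos q_pos _)
  set t := ((Fintype.card K : ℝ) ^ p.natDegree)⁻¹
  refine (one_add_mul_le_pow (a := t) (by linarith) m).trans ?_
  refine pow_le_pow_left₀ (by linarith) ?_ m
  rw [← one_div, le_div_iff₀ (by linarith)]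
  nlinarith [sq_nonneg t]

/-- The fractions of `arc PP h` with a given denominator number at most `|D| / q ^ h`. -/
theorem card_arc_filter_supp_le {PP : Finset K[X]} (hP : IsPrimeSet PP) (h : ℕ)
    {D : Finset K[X]} (hD : D ⊆ PP) :
    (((arc PP h).filter fun B => supp PP B = D).card : ℝ) ≤
      (Fintype.card K : ℝ) ^ wt D / (Fintype.card K : ℝ) ^ h := by
  set S := (arc PP h).filter fun B => supp PP B = D with hS
  rcases S.eq_empty_or_nonempty with he | ⟨B, hB⟩
  · rw [he]
    have := q_pos (K := K)
    simp only [Finset.card_empty, Nat.cast_zero]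
    positivity
  have hlt : h < wt D := by
    rw [hS, Finset.mem_filter] at hB
    rw [← hB.2]
    exact lt_wt_supp hP hB.1
  have hs := hP.mono (Finset.sdiff_subset (s := PP) (t := D))
  have hc : S.card ≤ Fintype.card K ^ (wt PP - h - (∏ p ∈ PP \ D, p).natDegree) := by
    refine card_le_of_sub_dvd hs.monic_prod.ne_zero ?_ ?_
    · intro A hA
      exact (mem_arc.1 (Finset.mem_filter.1 hA).1).2
    · have hdiv : ∀ A ∈ S, ∏ p ∈ PP \ D, p ∣ A := by
        intro A hA
        rw [hs.prod_dvd_iff]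
        intro p hp
        rw [Finset.mem_sdiff, ← (Finset.mem_filter.1 hA).2, mem_supp] at hp
        by_contra hcon
        exact hp.2 ⟨hp.1, hcon⟩
      exact fun A hA A' hA' => dvd_sub (hdiv A hA) (hdiv A' hA')
  have hw := wt_sdiff_add hD
  rw [hs.natDegree_prod, show wt PP - h - wt (PP \ D) = wt D - h by omega] at hc
  rw [div_eq_mul_inv, ← pow_sub₀ _ q_pos.ne' hlt.le]
  exact_mod_cast hc

/-! ### Representations of a fraction as a sum of two -/

/-- The products of two weights, summed over all fractions of norm less than `q ^ (-h)`. A given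
denominator `D` occurs at most `|D| / q ^ h` times, which leaves a sum of `1 / |D|`. -/
theorem sum_cf_mul_cf_le {PP : Finset K[X]} (hP : IsPrimeSet PP) (k m h : ℕ) :
    ∑ B ∈ arc PP h, cf PP k B * cf PP m B ≤
      ((Fintype.card K : ℝ) ^ h)⁻¹ * eulerZ PP ^ (k * m) := by
  rw [← Finset.sum_fiberwise_of_maps_to (s := arc PP h) (t := PP.powerset) (g := supp PP)
    fun B _ => Finset.mem_powerset.2 (supp_subset PP B)]
  refine le_trans ?_ (mul_le_mul_of_nonneg_left (sum_powerset_le hP (k * m))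
    (inv_nonneg.2 (pow_nonneg q_pos.le h)))
  rw [Finset.mul_sum]
  refine Finset.sum_le_sum fun D hD => ?_
  have h1 := card_arc_filter_supp_le hP h (Finset.mem_powerset.1 hD)
  have h2 : ∀ B ∈ (arc PP h).filter (fun B => supp PP B = D), cf PP k B * cf PP m B =
      ((k * m : ℕ) : ℝ) ^ D.card / ((Fintype.card K : ℝ) ^ wt D) ^ 2 := by
    intro B hB
    rw [cf, cf, (Finset.mem_filter.1 hB).2, div_mul_div_comm, ← mul_pow, Nat.cast_mul, sq]
  rw [Finset.sum_congr rfl h2, Finset.sum_const, nsmul_eq_mul]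
  refine (mul_le_mul_of_nonneg_right h1 (by positivity)).trans (le_of_eq ?_)
  have := q_pos (K := K)
  field_simp

/-- The part of the common denominator that cancels in the sum: the primes in both denominators
but not in that of the sum. -/
def canc (PP : Finset K[X]) (B B' : K[X]) : Finset K[X] :=
  (supp PP B ∩ supp PP B') \ supp PP (B + B')

/-- The primes shared by both denominators and by that of the sum. -/
def shar (PP : Finset K[X]) (B B' : K[X]) : Finset K[X] :=
  supp PP B ∩ supp PP B' ∩ supp PP (B + B')

theorem mem_canc {PP : Finset K[X]} {B B' p : K[X]} :
    p ∈ canc PP B B' ↔ p ∈ PP ∧ ¬ p ∣ B ∧ ¬ p ∣ B' ∧ p ∣ B + B' := by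
  simp only [canc, Finset.mem_sdiff, Finset.mem_inter, mem_supp]
  tauto

theorem mem_shar {PP : Finset K[X]} {B B' p : K[X]} :
    p ∈ shar PP B B' ↔ p ∈ PP ∧ ¬ p ∣ B ∧ ¬ p ∣ B' ∧ ¬ p ∣ B + B' := by
  simp only [shar, Finset.mem_inter, mem_supp]
  tauto

theorem link_eq (PP : Finset K[X]) (B B' : K[X]) :
    link PP B B' = 2 * wt (canc PP B B') + wt (shar PP B B') := by
  have h1 : canc PP B B' = PP.filter fun p => ¬ p ∣ B ∧ ¬ p ∣ B' ∧ p ∣ B + B' := by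
    ext p; rw [mem_canc, Finset.mem_filter]
  have h2 : shar PP B B' = PP.filter fun p => ¬ p ∣ B ∧ ¬ p ∣ B' ∧ ¬ p ∣ B + B' := by
    ext p; rw [mem_shar, Finset.mem_filter]
  rw [link, h1, h2, wt, wt, Finset.sum_filter, Finset.sum_filter, Finset.mul_sum,
    ← Finset.sum_add_distrib]
  refine Finset.sum_congr rfl fun p _ => ?_
  by_cases ha : p ∣ B <;> by_cases hb : p ∣ B' <;> by_cases hc : p ∣ B + B' <;> simp [ha, hb, hc]

/-- The denominator of `B` splits into the part missing from that of `B'`, the shared part and the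
cancelled part. -/
theorem supp_eq_union (PP : Finset K[X]) (B B' : K[X]) :
    supp PP B = (supp PP B \ supp PP B') ∪ shar PP B B' ∪ canc PP B B' := by
  ext p
  simp only [Finset.mem_union, Finset.mem_sdiff, mem_shar, mem_canc, mem_supp]
  tauto

/-- The denominator of the sum splits into the parts of the two denominators that are not
common and the shared part. -/
theorem supp_add_eq_union (PP : Finset K[X]) (B B' : K[X]) :
    supp PP (B + B') = (supp PP B \ supp PP B') ∪ shar PP B B' ∪ (supp PP B' \ supp PP B) := by
  ext p
  simp only [Finset.mem_union, Finset.mem_sdiff, mem_shar, mem_supp]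
  by_cases ha : p ∣ B
  · have := dvd_add_right (c := B') ha
    tauto
  · by_cases hb : p ∣ B'
    · have := dvd_add_left (b := B) hb
      tauto
    · tauto

theorem disjoint_parts (PP : Finset K[X]) (B B' : K[X]) :
    Disjoint (supp PP B \ supp PP B') (shar PP B B') ∧
    Disjoint ((supp PP B \ supp PP B') ∪ shar PP B B') (canc PP B B') ∧
    Disjoint ((supp PP B \ supp PP B') ∪ shar PP B B') (supp PP B' \ supp PP B) := by
  refine ⟨?_, ?_, ?_⟩ <;> rw [Finset.disjoint_left] <;> intro p <;>
    simp only [Finset.mem_union, Finset.mem_sdiff, mem_shar, mem_canc, mem_supp] <;> tauto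

theorem shar_comm (PP : Finset K[X]) (B B' : K[X]) : shar PP B B' = shar PP B' B := by
  rw [shar, shar, Finset.inter_comm (supp PP B), add_comm]

theorem canc_comm (PP : Finset K[X]) (B B' : K[X]) : canc PP B B' = canc PP B' B := by
  rw [canc, canc, Finset.inter_comm (supp PP B), add_comm]

theorem wt_supp_eq (PP : Finset K[X]) (B B' : K[X]) :
    wt (supp PP B) = wt (supp PP B \ supp PP B') + wt (shar PP B B') + wt (canc PP B B') := by
  obtain ⟨h1, h2, -⟩ := disjoint_parts PP B B'
  conv_lhs => rw [supp_eq_union PP B B', wt_union h2, wt_union h1]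

theorem card_supp_eq (PP : Finset K[X]) (B B' : K[X]) :
    (supp PP B).card = (supp PP B \ supp PP B').card + (shar PP B B').card +
      (canc PP B B').card := by
  obtain ⟨h1, h2, -⟩ := disjoint_parts PP B B'
  conv_lhs => rw [supp_eq_union PP B B', Finset.card_union_of_disjoint h2,
    Finset.card_union_of_disjoint h1]

theorem wt_supp_add_eq (PP : Finset K[X]) (B B' : K[X]) :
    wt (supp PP (B + B')) = wt (supp PP B \ supp PP B') + wt (shar PP B B') +
      wt (supp PP B' \ supp PP B) := by
  obtain ⟨h1, -, h3⟩ := disjoint_parts PP B B'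
  rw [supp_add_eq_union PP B B', wt_union h3, wt_union h1]

theorem card_supp_add_eq (PP : Finset K[X]) (B B' : K[X]) :
    (supp PP (B + B')).card = (supp PP B \ supp PP B').card + (shar PP B B').card +
      (supp PP B' \ supp PP B).card := by
  obtain ⟨h1, -, h3⟩ := disjoint_parts PP B B'
  rw [supp_add_eq_union PP B B', Finset.card_union_of_disjoint h3,
    Finset.card_union_of_disjoint h1]

/-- The representations `β = B + (β - B)` of a fraction as a sum of two, with given shared part
`s` and given part `x` of the first denominator that is missing from the second. -/
def repClass (PP : Finset K[X]) (h : ℕ) (β : K[X]) (s x : Finset K[X]) : Finset K[X] :=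
  (arc PP h).filter fun B => β - B ∈ arc PP h ∧ shar PP B (β - B) = s ∧
    supp PP B \ supp PP (β - B) = x

theorem repClass_dvd {PP : Finset K[X]} {h : ℕ} {β : K[X]} {s x : Finset K[X]} {B p : K[X]}
    (hB : B ∈ repClass PP h β s x) (hp : p ∈ PP) (hs : p ∉ s) (hc : p ∉ canc PP B (β - B)) :
    (p ∈ x → p ∣ β - B) ∧ (p ∉ x → p ∣ B) := by
  simp only [repClass, Finset.mem_filter] at hB
  obtain ⟨-, -, h1, h2⟩ := hB
  rw [← h1, mem_shar] at hs
  rw [← h2, Finset.mem_sdiff, mem_supp, mem_supp]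
  rw [mem_canc] at hc
  tauto

theorem mem_canc_rep {PP : Finset K[X]} {β B p : K[X]} (hp : p ∈ canc PP B (β - B)) :
    p ∈ PP ∧ ¬ p ∣ B ∧ p ∣ β := by
  rw [mem_canc, add_sub_cancel] at hp
  tauto

/-- Two representations in the same class agree modulo every prime outside the shared part and the
two cancelled parts. -/
theorem repClass_dvd_sub {PP : Finset K[X]} {h : ℕ} {β : K[X]} {s x : Finset K[X]} {B B' p : K[X]}
    (hB : B ∈ repClass PP h β s x) (hB' : B' ∈ repClass PP h β s x) (hp : p ∈ PP) (hs : p ∉ s)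
    (hc : p ∉ canc PP B (β - B)) (hc' : p ∉ canc PP B' (β - B')) : p ∣ B - B' := by
  have h1 := repClass_dvd hB hp hs hc
  have h2 := repClass_dvd hB' hp hs hc'
  by_cases hx : p ∈ x
  · have := dvd_sub (h2.1 hx) (h1.1 hx)
    rwa [sub_sub_sub_cancel_left] at this
  · exact dvd_sub (h1.2 hx) (h2.2 hx)

/-- With the cancelled part `C` prescribed as well, the representations agree modulo every prime
outside `s` and `C`. -/
theorem card_repClass_canc_eq_le {PP : Finset K[X]} (hP : IsPrimeSet PP) (h : ℕ) (β : K[X])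
    (s x C : Finset K[X]) :
    ((repClass PP h β s x).filter fun B => canc PP B (β - B) = C).card ≤
      Fintype.card K ^ (wt C + wt s - h) := by
  set S := (repClass PP h β s x).filter fun B => canc PP B (β - B) = C with hS
  have hs := hP.mono (Finset.sdiff_subset (s := PP) (t := s ∪ C))
  have hc : S.card ≤ Fintype.card K ^ (wt PP - h - (∏ p ∈ PP \ (s ∪ C), p).natDegree) := by
    refine card_le_of_sub_dvd hs.monic_prod.ne_zero ?_ ?_
    · intro A hA
      exact (mem_arc.1 (Finset.mem_filter.1 (Finset.mem_filter.1 hA).1).1).2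
    · intro A hA A' hA'
      rw [hS, Finset.mem_filter] at hA hA'
      rw [hs.prod_dvd_iff]
      intro p hp
      rw [Finset.mem_sdiff, Finset.mem_union, not_or] at hp
      exact repClass_dvd_sub hA.1 hA'.1 hp.1 hp.2.1 (by rw [hA.2]; exact hp.2.2)
        (by rw [hA'.2]; exact hp.2.2)
  refine hc.trans (Nat.pow_le_pow_right Fintype.card_pos ?_)
  rw [hs.natDegree_prod]
  have h1 : wt PP ≤ wt (PP \ (s ∪ C)) + wt (s ∪ C) := by
    rw [← wt_union Finset.sdiff_disjoint]
    exact wt_mono (by intro p hp; simp only [Finset.mem_union, Finset.mem_sdiff]; tauto)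
  have h2 : wt (s ∪ C) ≤ wt s + wt C := by
    have := Finset.sum_union_inter (s₁ := s) (s₂ := C) (f := fun p : K[X] => p.natDegree)
    unfold wt
    omega
  omega

/-- Fix one representation `B₀`, with cancelled part `C₀`. Any other `B` with cancelled part
`C` of the same degree gives the multiple `C₀ C (B - B₀)` of the part of the common denominator
prime to `s`. That multiple determines `B`: if `B` and `B'` give the same one, then
`C B - C' B' = (C - C') B₀`, where `C₀` divides the left side and is prime to `B₀`, so that `C₀`
divides `C - C'`, which has smaller degree. -/
theorem card_repClass_wt_eq_le {PP : Finset K[X]} (hP : IsPrimeSet PP) (h : ℕ) (β : K[X])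
    {s : Finset K[X]} (hsP : s ⊆ PP) (x : Finset K[X]) (c : ℕ) :
    ((repClass PP h β s x).filter fun B => wt (canc PP B (β - B)) = c).card ≤
      Fintype.card K ^ (2 * c + wt s - h) := by
  set S := (repClass PP h β s x).filter fun B => wt (canc PP B (β - B)) = c with hS
  rcases S.eq_empty_or_nonempty with he | ⟨B₀, hB₀⟩
  · simp [he]
  have hsub : ∀ B, canc PP B (β - B) ⊆ PP := fun B p hp => (mem_canc_rep hp).1
  set Γ : K[X] → K[X] := fun B => ∏ p ∈ canc PP B (β - B), p with hΓ
  have hΓm : ∀ B, (Γ B).Monic := fun B => (hP.mono (hsub B)).monic_prod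
  have hΓd : ∀ B ∈ S, (Γ B).natDegree = c := fun B hB => by
    rw [(hP.mono (hsub B)).natDegree_prod, (Finset.mem_filter.1 hB).2]
  have hpΓ : ∀ B, ∀ p ∈ PP, (p ∣ Γ B ↔ p ∈ canc PP B (β - B)) := fun B p hp =>
    hP.dvd_prod_iff (hsub B) hp
  have hs := hP.mono (Finset.sdiff_subset (s := PP) (t := s))
  set W : K[X] := ∏ p ∈ PP \ s, p with hW
  have hW0 : W ≠ 0 := hs.monic_prod.ne_zero
  have hWd : W.natDegree + wt s = wt PP := by
    rw [hW, hs.natDegree_prod, wt_sdiff_add hsP]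
  have hdvd : ∀ B ∈ S, W ∣ Γ B₀ * Γ B * (B - B₀) := by
    intro B hB
    rw [hW, hs.prod_dvd_iff]
    intro p hp
    rw [Finset.mem_sdiff] at hp
    by_cases h1 : p ∣ Γ B₀
    · exact (h1.mul_right _).mul_right _
    by_cases h2 : p ∣ Γ B
    · exact (h2.mul_left _).mul_right _
    rw [hpΓ _ _ hp.1] at h1 h2
    exact (repClass_dvd_sub (Finset.mem_filter.1 hB).1 (Finset.mem_filter.1 hB₀).1 hp.1 hp.2 h2
      h1).mul_left _
  have hmem : ∀ B ∈ S, B ∈ arc PP h := fun B hB =>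
    (Finset.mem_filter.1 (Finset.mem_filter.1 hB).1).1
  have key : ∀ B ∈ S, W * (Γ B₀ * Γ B * (B - B₀) / W) = Γ B₀ * Γ B * (B - B₀) := fun B hB =>
    EuclideanDomain.mul_div_cancel' hW0 (hdvd B hB)
  rw [← card_polyLT (K := K)]
  refine Finset.card_le_card_of_injOn (fun B => Γ B₀ * Γ B * (B - B₀) / W) ?_ ?_
  · intro B hB
    by_cases h0 : Γ B₀ * Γ B * (B - B₀) / W = 0
    · simp only [h0]
      exact zero_mem_polyLT _
    · refine (mem_polyLT_iff h0).2 ?_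
      have h1 : B - B₀ ≠ 0 := by
        intro hc
        apply h0
        rw [hc, mul_zero, EuclideanDomain.zero_div]
      have h2 := (mem_polyLT_iff h1).1
        (sub_mem_polyLT (mem_arc.1 (hmem B hB)).2 (mem_arc.1 (hmem B₀ hB₀)).2)
      have h3 := congrArg natDegree (key B hB)
      rw [natDegree_mul hW0 h0, natDegree_mul (mul_ne_zero (hΓm _).ne_zero (hΓm _).ne_zero) h1,
        natDegree_mul (hΓm _).ne_zero (hΓm _).ne_zero, hΓd B hB, hΓd B₀ hB₀] at h3
      omega
  · intro B hB B' hB' heq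
    have h1 := key B hB
    simp only at heq
    rw [heq, key B' hB', mul_assoc, mul_assoc] at h1
    have h2 := mul_left_cancel₀ (hΓm B₀).ne_zero h1
    have hprod : ∀ A ∈ S, ∀ p ∈ canc PP B₀ (β - B₀), p ∣ Γ A * A ∨ p ∈ x := by
      intro A hA p hp
      by_cases hpA : p ∈ canc PP A (β - A)
      · exact Or.inl (((hpΓ A p (mem_canc_rep hp).1).2 hpA).mul_right _)
      · have hps : p ∉ s := by
          intro hc
          have h3 := (Finset.mem_filter.1 (Finset.mem_filter.1 hB₀).1).2.2.1
          rw [← h3, mem_shar, add_sub_cancel] at hc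
          exact hc.2.2.2 (mem_canc_rep hp).2.2
        have h4 := repClass_dvd (Finset.mem_filter.1 hA).1 (mem_canc_rep hp).1 hps hpA
        by_cases hx : p ∈ x
        · exact Or.inr hx
        · exact Or.inl ((h4.2 hx).mul_left _)
    have hx : ∀ p ∈ canc PP B₀ (β - B₀), p ∉ x := by
      intro p hp hc
      have h3 := (Finset.mem_filter.1 (Finset.mem_filter.1 hB₀).1).2.2.2
      rw [← h3, Finset.mem_sdiff, mem_supp, mem_supp] at hc
      rw [mem_canc] at hp
      tauto
    have h5 : Γ B₀ ∣ Γ B - Γ B' := by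
      rw [hΓ, (hP.mono (hsub B₀)).prod_dvd_iff]
      intro p hp
      have h6 := (hprod B hB p hp).resolve_right (hx p hp)
      have h7 := (hprod B' hB' p hp).resolve_right (hx p hp)
      have h8 : (Γ B - Γ B') * B₀ = Γ B * B - Γ B' * B' := by linear_combination h2
      have h9 : p ∣ (Γ B - Γ B') * B₀ := h8 ▸ dvd_sub h6 h7
      exact ((hP p (mem_canc_rep hp).1).2.prime.dvd_or_dvd h9).resolve_right (mem_canc_rep hp).2.1
    have h10 : Γ B = Γ B' := by
      by_contra hne
      have h11 := degree_le_of_dvd h5 (sub_ne_zero.2 hne)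
      have h12 : (Γ B - Γ B').degree < (Γ B).degree := degree_sub_lt_left
        (by rw [degree_eq_natDegree (hΓm B).ne_zero, degree_eq_natDegree (hΓm B').ne_zero,
          hΓd B hB, hΓd B' hB']) (hΓm B).ne_zero
        (by rw [(hΓm B).leadingCoeff, (hΓm B').leadingCoeff])
      rw [degree_eq_natDegree (hΓm B).ne_zero, hΓd B hB, ← hΓd B₀ hB₀,
        ← degree_eq_natDegree (hΓm B₀).ne_zero] at h12
      exact absurd h11 (not_le.2 h12)
    rw [h10] at h2
    exact (sub_left_inj.1 (mul_left_cancel₀ (hΓm B').ne_zero h2)).symm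

/-! ### Weighted pair sums -/

variable (K) in
/-- The divisor bound: only the primes of bounded degree can contribute a factor `k` that exceeds
`|p| ^ ε`. -/
theorem exists_pow_card_le (k : ℕ) {ε : ℝ} (hε : 0 < ε) :
    ∃ A : ℝ, 1 ≤ A ∧ ∀ C : Finset K[X], IsPrimeSet C →
      (k : ℝ) ^ C.card ≤ A * ((Fintype.card K : ℝ) ^ wt C) ^ ε := by
  have hqε : 1 < (Fintype.card K : ℝ) ^ ε := Real.one_lt_rpow one_lt_q hε
  obtain ⟨N, hN⟩ := pow_unbounded_of_one_lt (k : ℝ) hqε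
  have hk1 : (1 : ℝ) ≤ max (k : ℝ) 1 := le_max_right _ _
  refine ⟨max (k : ℝ) 1 ^ (polyLT K N).card, one_le_pow₀ hk1, fun C hC => ?_⟩
  have hpow : ((Fintype.card K : ℝ) ^ wt C) ^ ε =
      ∏ p ∈ C, ((Fintype.card K : ℝ) ^ ε) ^ p.natDegree := by
    rw [Finset.prod_pow_eq_pow_sum, ← wt, ← Real.rpow_natCast, ← Real.rpow_natCast,
      ← Real.rpow_mul q_pos.le, ← Real.rpow_mul q_pos.le, mul_comm]
  have hstep : ∀ p ∈ C, (k : ℝ) ≤ (if p ∈ polyLT K N then max (k : ℝ) 1 else 1) *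
      ((Fintype.card K : ℝ) ^ ε) ^ p.natDegree := by
    intro p hp
    split_ifs with hpN
    · calc (k : ℝ) ≤ max (k : ℝ) 1 * 1 := by rw [mul_one]; exact le_max_left _ _
        _ ≤ _ := mul_le_mul_of_nonneg_left (one_le_pow₀ hqε.le) (by positivity)
    · rw [one_mul]
      rw [mem_polyLT_iff (hC p hp).1.ne_zero, not_lt] at hpN
      exact hN.le.trans (pow_le_pow_right₀ hqε.le hpN)
  have h1 : (k : ℝ) ^ C.card ≤ ∏ p ∈ C, ((if p ∈ polyLT K N then max (k : ℝ) 1 else 1) *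
      ((Fintype.card K : ℝ) ^ ε) ^ p.natDegree) := by
    rw [← Finset.prod_const]
    exact Finset.prod_le_prod (fun _ _ => by positivity) hstep
  refine h1.trans ?_
  rw [Finset.prod_mul_distrib, ← hpow, ← Finset.prod_filter, Finset.prod_const]
  refine mul_le_mul_of_nonneg_right (pow_le_pow_right₀ hk1 (Finset.card_le_card ?_)) ?_
  · intro p hp
    exact (Finset.mem_filter.1 hp).2
  · exact Real.rpow_nonneg (pow_nonneg q_pos.le _) _

/-- A polynomial in `h` is absorbed by a power of `q ^ h`. -/
theorem exists_natCast_add_one_le {a : ℝ} (ha : 1 < a) {ε : ℝ} (hε : 0 < ε) :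
    ∃ A : ℝ, 1 ≤ A ∧ ∀ h : ℕ, (h : ℝ) + 1 ≤ A * (a ^ h) ^ ε := by
  have haε : 1 < a ^ ε := Real.one_lt_rpow ha hε
  have hpos : 0 < a ^ ε - 1 := by linarith
  refine ⟨max 1 (1 / (a ^ ε - 1)), le_max_left _ _, fun h => ?_⟩
  have h1 : (a ^ h) ^ ε = (a ^ ε) ^ h := by
    rw [← Real.rpow_natCast, ← Real.rpow_natCast, ← Real.rpow_mul (by linarith),
      ← Real.rpow_mul (by linarith), mul_comm]
  have h2 := one_add_mul_le_pow (a := a ^ ε - 1) (by linarith) h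
  rw [add_sub_cancel] at h2
  rw [h1]
  have h3 : (h : ℝ) ≤ (1 / (a ^ ε - 1)) * (h * (a ^ ε - 1)) := by
    rw [one_div, mul_comm (h : ℝ), inv_mul_cancel_left₀ hpos.ne']
  have h4 : (1 / (a ^ ε - 1)) * (h * (a ^ ε - 1)) ≤ max 1 (1 / (a ^ ε - 1)) * (h * (a ^ ε - 1)) :=
    mul_le_mul_of_nonneg_right (le_max_right _ _) (by positivity)
  have h5 : max 1 (1 / (a ^ ε - 1)) * (1 + h * (a ^ ε - 1)) ≤
      max 1 (1 / (a ^ ε - 1)) * (a ^ ε) ^ h := mul_le_mul_of_nonneg_left h2 (by positivity)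
  have h6 : (1 : ℝ) ≤ max 1 (1 / (a ^ ε - 1)) := le_max_left _ _
  linarith

/-- Truncated subtraction as a maximum: `max 1 (E / H) * min E H = E`. -/
theorem pow_tsub_mul_pow_min (q : ℝ) (e h : ℕ) : q ^ (e - h) * q ^ min e h = q ^ e := by
  rw [← pow_add]
  congr 1
  omega

/-- The sum over one class of representations. Cancelled parts of norm at most `q ^ h` are counted
by their degree, the larger ones individually. -/
theorem sum_repClass_le {PP : Finset K[X]} (hP : IsPrimeSet PP) (h : ℕ) (β : K[X])
    {s : Finset K[X]} (hs : s ⊆ PP) (x : Finset K[X]) (m : ℕ) {A ε : ℝ} (hA : 1 ≤ A) (hε : 0 < ε)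
    (hdiv : ∀ C : Finset K[X], IsPrimeSet C →
      (m : ℝ) ^ C.card ≤ A * ((Fintype.card K : ℝ) ^ wt C) ^ ε) :
    ∑ B ∈ repClass PP h β s x, (m : ℝ) ^ (canc PP B (β - B)).card *
      ((Fintype.card K : ℝ) ^ min (link PP B (β - B)) h /
        (Fintype.card K : ℝ) ^ link PP B (β - B)) ≤
      ((h : ℝ) + 1) * (A * ((Fintype.card K : ℝ) ^ h) ^ ε) + eulerZ PP ^ m := by
  have hq := q_pos (K := K)
  set q : ℝ := (Fintype.card K : ℝ) with hqdef
  have hq1 : 1 < q := one_lt_q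
  have hlink : ∀ B ∈ repClass PP h β s x,
      link PP B (β - B) = 2 * wt (canc PP B (β - B)) + wt s := by
    intro B hB
    rw [link_eq, (Finset.mem_filter.1 hB).2.2.1]
  rw [← Finset.sum_filter_add_sum_filter_not _ (fun B => wt (canc PP B (β - B)) ≤ h)]
  refine add_le_add ?_ ?_
  · rw [← Finset.sum_fiberwise_of_maps_to (t := Finset.range (h + 1))
      (g := fun B => wt (canc PP B (β - B)))
      (fun B hB => Finset.mem_range.2 (Nat.lt_succ_of_le (Finset.mem_filter.1 hB).2))]
    have hc : ∀ c ∈ Finset.range (h + 1),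
        ∑ B ∈ ((repClass PP h β s x).filter (fun B => wt (canc PP B (β - B)) ≤ h)).filter
          (fun B => wt (canc PP B (β - B)) = c), (m : ℝ) ^ (canc PP B (β - B)).card *
          (q ^ min (link PP B (β - B)) h / q ^ link PP B (β - B)) ≤ A * (q ^ h) ^ ε := by
      intro c hc
      have hch : c ≤ h := Nat.lt_succ_iff.1 (Finset.mem_range.1 hc)
      have hcard : ((((repClass PP h β s x).filter (fun B => wt (canc PP B (β - B)) ≤ h)).filter
          (fun B => wt (canc PP B (β - B)) = c)).card : ℝ) ≤ q ^ (2 * c + wt s - h) := by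
        refine le_trans ?_ (b := ((((repClass PP h β s x)).filter
          (fun B => wt (canc PP B (β - B)) = c)).card : ℝ)) ?_
        · exact_mod_cast Finset.card_le_card
            (Finset.filter_subset_filter _ (Finset.filter_subset _ _))
        · rw [hqdef]
          exact_mod_cast card_repClass_wt_eq_le hP h β hs x c
      have hterm : ∀ B ∈ ((repClass PP h β s x).filter
          (fun B => wt (canc PP B (β - B)) ≤ h)).filter (fun B => wt (canc PP B (β - B)) = c),
          (m : ℝ) ^ (canc PP B (β - B)).card *
          (q ^ min (link PP B (β - B)) h / q ^ link PP B (β - B)) ≤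
          (A * (q ^ h) ^ ε) * (q ^ min (2 * c + wt s) h / q ^ (2 * c + wt s)) := by
        intro B hB
        rw [Finset.mem_filter, Finset.mem_filter] at hB
        rw [hlink B hB.1.1, hB.2]
        refine mul_le_mul_of_nonneg_right ?_ (by positivity)
        refine (hdiv _ (hP.mono fun p hp => (mem_canc_rep hp).1)).trans ?_
        refine mul_le_mul_of_nonneg_left ?_ (by linarith)
        rw [hB.2]
        exact Real.rpow_le_rpow (by positivity) (pow_le_pow_right₀ hq1.le hch) hε.le
      refine (Finset.sum_le_card_nsmul _ _ _ hterm).trans ?_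
      rw [nsmul_eq_mul]
      have h0 : 0 ≤ A * (q ^ h) ^ ε := by positivity
      refine (mul_le_mul_of_nonneg_right hcard (by positivity)).trans (le_of_eq ?_)
      rw [mul_left_comm, mul_div_assoc', pow_tsub_mul_pow_min, div_self (by positivity), mul_one]
    refine (Finset.sum_le_card_nsmul _ _ _ hc).trans (le_of_eq ?_)
    rw [nsmul_eq_mul, Finset.card_range]
    push_cast
    ring
  · refine le_trans ?_ (sum_powerset_le hP m)
    rw [← Finset.sum_fiberwise_of_maps_to (t := PP.powerset)
      (g := fun B => canc PP B (β - B))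
      (fun B _ => Finset.mem_powerset.2 fun p hp => (mem_canc_rep hp).1)]
    refine Finset.sum_le_sum fun C _ => ?_
    by_cases hCh : wt C ≤ h
    · refine le_trans (le_of_eq ?_) (by positivity : (0 : ℝ) ≤ (m : ℝ) ^ C.card / q ^ wt C)
      refine Finset.sum_eq_zero fun B hB => ?_
      rw [Finset.mem_filter, Finset.mem_filter] at hB
      exact absurd (hB.2 ▸ hCh) hB.1.2
    have hcard : ((((repClass PP h β s x).filter (fun B => ¬ wt (canc PP B (β - B)) ≤ h)).filter
        (fun B => canc PP B (β - B) = C)).card : ℝ) ≤ q ^ (wt C + wt s - h) := by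
      refine le_trans ?_ (b := ((((repClass PP h β s x)).filter
        (fun B => canc PP B (β - B) = C)).card : ℝ)) ?_
      · exact_mod_cast Finset.card_le_card
          (Finset.filter_subset_filter _ (Finset.filter_subset _ _))
      · rw [hqdef]
        exact_mod_cast card_repClass_canc_eq_le hP h β s x C
    have hterm : ∀ B ∈ ((repClass PP h β s x).filter
        (fun B => ¬ wt (canc PP B (β - B)) ≤ h)).filter (fun B => canc PP B (β - B) = C),
        (m : ℝ) ^ (canc PP B (β - B)).card *
        (q ^ min (link PP B (β - B)) h / q ^ link PP B (β - B)) ≤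
        (m : ℝ) ^ C.card * (q ^ h / q ^ (2 * wt C + wt s)) := by
      intro B hB
      rw [Finset.mem_filter, Finset.mem_filter] at hB
      rw [hlink B hB.1.1, hB.2, min_eq_right (by omega)]
    refine (Finset.sum_le_card_nsmul _ _ _ hterm).trans ?_
    rw [nsmul_eq_mul]
    refine (mul_le_mul_of_nonneg_right hcard (by positivity)).trans (le_of_eq ?_)
    have h2 : q ^ (2 * wt C + wt s) = q ^ (wt C + wt s - h) * q ^ h * q ^ wt C := by
      rw [← pow_add, ← pow_add]
      congr 1
      omega
    rw [h2, ← hqdef]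
    field_simp

/-- The pair sums of a fixed fraction `β`, weighted by the size of the common part of the two
denominators, capped at `q ^ h`: up to `q ^ (h ε)` and Euler products, at most a weight of the same
kind at `β`. -/
theorem exists_pairSum_le (k l : ℕ) {ε : ℝ} (hε : 0 < ε) :
    ∃ A : ℝ, 0 < A ∧ ∀ PP : Finset K[X], IsPrimeSet PP → ∀ (h : ℕ) (β : K[X]),
      ∑ B ∈ (arc PP h).filter (fun B => β - B ∈ arc PP h), cf PP k B * cf PP l (β - B) *
        (Fintype.card K : ℝ) ^ min (link PP B (β - B)) h ≤
      A * ((Fintype.card K : ℝ) ^ h) ^ ε * eulerZ PP ^ (k * l) * cf PP (k + l + k * l) β := by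
  have hq := q_pos (K := K)
  obtain ⟨A₁, hA₁, hdiv⟩ := exists_pow_card_le K (k * l) (half_pos hε)
  obtain ⟨A₂, hA₂, hlog⟩ := exists_natCast_add_one_le (one_lt_q (K := K)) (half_pos hε)
  refine ⟨A₂ * A₁ + 1, by positivity, fun PP hP h β => ?_⟩
  set q : ℝ := (Fintype.card K : ℝ) with hqdef
  have hq1 : 1 < q := one_lt_q
  have hsum : ∀ s ∈ (supp PP β).powerset, ∀ x : Finset K[X],
      ∑ B ∈ repClass PP h β s x, ((k * l : ℕ) : ℝ) ^ (canc PP B (β - B)).card *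
      (q ^ min (link PP B (β - B)) h / q ^ link PP B (β - B)) ≤
      (A₂ * A₁ + 1) * (q ^ h) ^ ε * eulerZ PP ^ (k * l) := by
    intro s hs x
    refine (sum_repClass_le hP h β ((Finset.mem_powerset.1 hs).trans (supp_subset _ _)) x (k * l)
      hA₁ (half_pos hε) hdiv).trans ?_
    have hZ : 1 ≤ eulerZ PP ^ (k * l) := one_le_pow₀ (one_le_eulerZ hP)
    have hH : 1 ≤ (q ^ h) ^ ε := Real.one_le_rpow (one_le_pow₀ hq1.le) hε.le
    have h1 : (q ^ h) ^ ε = (q ^ h) ^ (ε / 2) * (q ^ h) ^ (ε / 2) := by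
      rw [← Real.rpow_add (by positivity), add_halves]
    have h2 : ((h : ℝ) + 1) * (A₁ * (q ^ h) ^ (ε / 2)) ≤ A₂ * A₁ * (q ^ h) ^ ε := by
      rw [h1]
      calc ((h : ℝ) + 1) * (A₁ * (q ^ h) ^ (ε / 2))
          ≤ (A₂ * (q ^ h) ^ (ε / 2)) * (A₁ * (q ^ h) ^ (ε / 2)) :=
            mul_le_mul_of_nonneg_right (hlog h) (by positivity)
        _ = _ := by ring
    calc _ ≤ A₂ * A₁ * (q ^ h) ^ ε + eulerZ PP ^ (k * l) := by linarith
      _ ≤ A₂ * A₁ * (q ^ h) ^ ε * eulerZ PP ^ (k * l) + (q ^ h) ^ ε * eulerZ PP ^ (k * l) := by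
          refine add_le_add (le_mul_of_one_le_right (by positivity) hZ)
            (le_mul_of_one_le_left (by positivity) hH)
      _ = _ := by ring
  have hterm : ∀ s x : Finset K[X], ∀ B ∈ repClass PP h β s x,
      cf PP k B * cf PP l (β - B) * q ^ min (link PP B (β - B)) h =
      ((((k * l : ℕ) : ℝ) ^ s.card * ((k : ℝ) ^ x.card *
        (l : ℝ) ^ ((supp PP β).card - s.card - x.card))) / q ^ wt (supp PP β)) *
      (((k * l : ℕ) : ℝ) ^ (canc PP B (β - B)).card *
      (q ^ min (link PP B (β - B)) h / q ^ link PP B (β - B))) := by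
    intro s x B hB
    obtain ⟨-, -, hs, hx⟩ := Finset.mem_filter.1 hB
    have hw := wt_supp_add_eq PP B (β - B)
    have hw1 := wt_supp_eq PP B (β - B)
    have hw2 := wt_supp_eq PP (β - B) B
    have hc := card_supp_add_eq PP B (β - B)
    have hc1 := card_supp_eq PP B (β - B)
    have hc2 := card_supp_eq PP (β - B) B
    rw [← shar_comm, ← canc_comm] at hw2 hc2
    rw [add_sub_cancel] at hw hc
    rw [hs] at hw hw1 hw2 hc hc1 hc2
    rw [hx] at hw hw1 hc hc1
    have hl := link_eq PP B (β - B)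
    rw [hs] at hl
    have hd : q ^ wt (supp PP B) * q ^ wt (supp PP (β - B)) =
        q ^ wt (supp PP β) * q ^ link PP B (β - B) := by
      rw [← pow_add, ← pow_add]
      congr 1
      omega
    have hn : (k : ℝ) ^ (supp PP B).card * (l : ℝ) ^ (supp PP (β - B)).card =
        (((k * l : ℕ) : ℝ) ^ s.card * ((k : ℝ) ^ x.card *
        (l : ℝ) ^ ((supp PP β).card - s.card - x.card))) *
        ((k * l : ℕ) : ℝ) ^ (canc PP B (β - B)).card := by
      rw [show (supp PP β).card - s.card - x.card = (supp PP (β - B) \ supp PP B).card by omega,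
        hc1, hc2]
      push_cast
      ring
    rw [cf, cf, div_mul_div_comm, ← hqdef, hd, hn]
    field_simp
  set R := A₂ * A₁ + 1 with hR
  set T := (arc PP h).filter (fun B => β - B ∈ arc PP h) with hT
  rw [← Finset.sum_fiberwise_of_maps_to (t := (supp PP β).powerset)
    (g := fun B => shar PP B (β - B)) (fun B _ => by
      rw [Finset.mem_powerset, shar, add_sub_cancel]
      exact Finset.inter_subset_right)]
  have hinner : ∀ s ∈ (supp PP β).powerset,
      ∑ B ∈ T.filter (fun B => shar PP B (β - B) = s), cf PP k B * cf PP l (β - B) *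
        q ^ min (link PP B (β - B)) h ≤
      ((k * l : ℕ) : ℝ) ^ s.card * ((k : ℝ) + l) ^ ((supp PP β).card - s.card) *
        ((R * (q ^ h) ^ ε * eulerZ PP ^ (k * l)) / q ^ wt (supp PP β)) := by
    intro s hs
    have hsβ := Finset.mem_powerset.1 hs
    rw [← Finset.sum_fiberwise_of_maps_to (t := (supp PP β \ s).powerset)
      (g := fun B => supp PP B \ supp PP (β - B)) (fun B hB => by
        have h1 := supp_add_eq_union PP B (β - B)
        have h2 := (disjoint_parts PP B (β - B)).1
        rw [add_sub_cancel, (Finset.mem_filter.1 hB).2] at h1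
        rw [(Finset.mem_filter.1 hB).2] at h2
        rw [Finset.mem_powerset, Finset.subset_sdiff]
        refine ⟨?_, h2⟩
        rw [h1, Finset.union_assoc]
        exact Finset.subset_union_left)]
    have hx : ∀ x ∈ (supp PP β \ s).powerset,
        ∑ B ∈ (T.filter (fun B => shar PP B (β - B) = s)).filter
          (fun B => supp PP B \ supp PP (β - B) = x), cf PP k B * cf PP l (β - B) *
          q ^ min (link PP B (β - B)) h ≤
        ((k : ℝ) ^ x.card * (l : ℝ) ^ ((supp PP β \ s).card - x.card)) *
          (((k * l : ℕ) : ℝ) ^ s.card *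
          ((R * (q ^ h) ^ ε * eulerZ PP ^ (k * l)) / q ^ wt (supp PP β))) := by
      intro x _
      have he : (T.filter (fun B => shar PP B (β - B) = s)).filter
          (fun B => supp PP B \ supp PP (β - B) = x) = repClass PP h β s x := by
        rw [hT, Finset.filter_filter, Finset.filter_filter, repClass]
      rw [he, Finset.sum_congr rfl (hterm s x), ← Finset.mul_sum]
      refine (mul_le_mul_of_nonneg_left (hsum s hs x) (by positivity)).trans (le_of_eq ?_)
      rw [Finset.card_sdiff_of_subset hsβ]
      ring
    refine (Finset.sum_le_sum hx).trans (le_of_eq ?_)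
    rw [← Finset.sum_mul, Finset.sum_pow_mul_eq_add_pow, Finset.card_sdiff_of_subset hsβ]
    ring
  refine (Finset.sum_le_sum hinner).trans (le_of_eq ?_)
  rw [← Finset.sum_mul, Finset.sum_pow_mul_eq_add_pow, cf]
  push_cast
  rw [show (k : ℝ) * l + (k + l) = k + l + k * l by ring, ← hqdef]
  ring

/-! ### Triples, and matchings in quintuples -/

/-- Sums over pairs with nonzero sum, grouped by that sum. -/
theorem sum_pairs_eq (PP : Finset K[X]) (h : ℕ) (w : K[X] → K[X] → ℝ) (G : K[X] → ℝ) :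
    ∑ a ∈ arc PP h, ∑ b ∈ arc PP h, (if a + b ≠ 0 then w a b * G (a + b) else 0) =
      ∑ β ∈ arc PP h, (∑ B ∈ (arc PP h).filter (fun B => β - B ∈ arc PP h), w B (β - B)) * G β := by
  simp_rw [Finset.sum_mul, Finset.sum_filter]
  rw [Finset.sum_comm (s := arc PP h) (t := arc PP h)
    (f := fun β B => if β - B ∈ arc PP h then w B (β - B) * G β else 0)]
  refine Finset.sum_congr rfl fun a ha => ?_
  rw [← Finset.sum_filter, ← Finset.sum_filter]
  refine Finset.sum_nbij' (fun b => a + b) (fun β => β - a) ?_ ?_ ?_ ?_ ?_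
  · intro b hb
    rw [Finset.mem_filter] at hb ⊢
    rw [add_sub_cancel_left]
    exact ⟨add_mem_arc ha hb.1 hb.2, hb.1⟩
  · intro β hβ
    rw [Finset.mem_filter] at hβ ⊢
    rw [add_sub_cancel]
    exact ⟨hβ.2, (mem_arc.1 hβ.1).1⟩
  · intro b _
    exact add_sub_cancel_left a b
  · intro β _
    exact add_sub_cancel a β
  · intro b _
    rw [add_sub_cancel_left]

/-- A sum over triples, weighted by the common part of two of the denominators. -/
theorem exists_tripleSum_link_le (k l m : ℕ) {ε : ℝ} (hε : 0 < ε) :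
    ∃ A : ℝ, 0 < A ∧ ∀ PP : Finset K[X], IsPrimeSet PP → ∀ h : ℕ,
      ∑ a ∈ arc PP h, ∑ b ∈ arc PP h, ∑ c ∈ arc PP h, (if a + b + c = 0 then
        cf PP k a * cf PP l b * (Fintype.card K : ℝ) ^ min (link PP a b) h * cf PP m c else 0) ≤
      A * ((Fintype.card K : ℝ) ^ h) ^ ε * ((Fintype.card K : ℝ) ^ h)⁻¹ *
        eulerZ PP ^ (k * l + (k + l + k * l) * m) := by
  obtain ⟨A, hA, hpair⟩ := exists_pairSum_le (K := K) k l hε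
  refine ⟨A, hA, fun PP hP h => ?_⟩
  have hq := q_pos (K := K)
  have hZ : 0 ≤ eulerZ PP := zero_le_one.trans (one_le_eulerZ hP)
  set q : ℝ := (Fintype.card K : ℝ) with hqdef
  have h1 : ∑ a ∈ arc PP h, ∑ b ∈ arc PP h, ∑ c ∈ arc PP h, (if a + b + c = 0 then
        cf PP k a * cf PP l b * q ^ min (link PP a b) h * cf PP m c else 0) =
      ∑ a ∈ arc PP h, ∑ b ∈ arc PP h, (if a + b ≠ 0 then
        (cf PP k a * cf PP l b * q ^ min (link PP a b) h) * cf PP m (a + b) else 0) := by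
    refine Finset.sum_congr rfl fun a ha => Finset.sum_congr rfl fun b hb => ?_
    split_ifs with h0
    · rw [Finset.sum_eq_single (-(a + b))]
      · rw [add_neg_cancel, if_pos rfl, cf_neg]
      · intro c _ hc
        rw [if_neg]
        intro h2
        exact hc (eq_neg_of_add_eq_zero_right h2)
      · intro hc
        exact absurd (neg_mem_arc (add_mem_arc ha hb h0)) hc
    · refine Finset.sum_eq_zero fun c hc => ?_
      rw [not_not] at h0
      rw [h0, zero_add, if_neg (mem_arc.1 hc).1]
  rw [h1, sum_pairs_eq PP h (fun a b => cf PP k a * cf PP l b * q ^ min (link PP a b) h)]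
  calc _ ≤ ∑ β ∈ arc PP h, (A * (q ^ h) ^ ε * eulerZ PP ^ (k * l) * cf PP (k + l + k * l) β) *
        cf PP m β :=
        Finset.sum_le_sum fun β _ => mul_le_mul_of_nonneg_right (hpair PP hP h β) (cf_nonneg _ _ _)
    _ = A * (q ^ h) ^ ε * eulerZ PP ^ (k * l) *
        ∑ β ∈ arc PP h, cf PP (k + l + k * l) β * cf PP m β := by
        rw [Finset.mul_sum]
        exact Finset.sum_congr rfl fun β _ => by ring
    _ ≤ A * (q ^ h) ^ ε * eulerZ PP ^ (k * l) * ((q ^ h)⁻¹ * eulerZ PP ^ ((k + l + k * l) * m)) :=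
        mul_le_mul_of_nonneg_left (sum_cf_mul_cf_le hP _ _ h) (by positivity)
    _ = _ := by rw [pow_add]; ring

/-- The sum over triples of fractions with sum zero. -/
theorem exists_tripleSum_le (k l m : ℕ) {ε : ℝ} (hε : 0 < ε) :
    ∃ A : ℝ, 0 < A ∧ ∀ PP : Finset K[X], IsPrimeSet PP → ∀ h : ℕ,
      ∑ a ∈ arc PP h, ∑ b ∈ arc PP h, ∑ c ∈ arc PP h, (if a + b + c = 0 then
        cf PP k a * cf PP l b * cf PP m c else 0) ≤
      A * ((Fintype.card K : ℝ) ^ h) ^ ε * ((Fintype.card K : ℝ) ^ h)⁻¹ ^ 2 *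
        eulerZ PP ^ (k * l + k * m + l * m + k * l * m) := by
  obtain ⟨A, hA, h1⟩ := exists_tripleSum_link_le (K := K) k l m hε
  obtain ⟨B, hB, h2⟩ := exists_tripleSum_link_le (K := K) k m l hε
  refine ⟨A + B, by positivity, fun PP hP h => ?_⟩
  have hq := q_pos (K := K)
  specialize h1 PP hP h
  specialize h2 PP hP h
  set q : ℝ := (Fintype.card K : ℝ) with hqdef
  have hq1 : 1 < q := one_lt_q
  have key : ∀ a ∈ arc PP h, ∀ b ∈ arc PP h, ∀ c ∈ arc PP h,
      (if a + b + c = 0 then cf PP k a * cf PP l b * cf PP m c else 0) ≤ (q ^ h)⁻¹ *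
      ((if a + b + c = 0 then cf PP k a * cf PP l b * q ^ min (link PP a b) h * cf PP m c else 0) +
      (if a + c + b = 0 then cf PP k a * cf PP m c * q ^ min (link PP a c) h * cf PP l b else 0)) := by
    intro a ha b _ c _
    by_cases h0 : a + b + c = 0
    · rw [add_right_comm a c b, if_pos h0, if_pos h0, if_pos h0]
      have hv := two_mul_wt_supp_le (PP := PP) Finset.univ a ![b, c]
        (by simpa [Fin.sum_univ_two, add_assoc] using h0)
      simp only [Fin.sum_univ_two, Matrix.cons_val_zero, Matrix.cons_val_one] at hv
      have hlt := lt_wt_supp hP ha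
      have hle : q ^ h ≤ q ^ min (link PP a b) h + q ^ min (link PP a c) h := by
        rcases le_total h (link PP a b) with h3 | h3
        · rw [min_eq_right h3]
          exact le_add_of_nonneg_right (by positivity)
        · rw [min_eq_right (show h ≤ link PP a c by omega)]
          exact le_add_of_nonneg_left (by positivity)
      have hc0 : 0 ≤ cf PP k a * cf PP l b * cf PP m c :=
        mul_nonneg (mul_nonneg (cf_nonneg _ _ _) (cf_nonneg _ _ _)) (cf_nonneg _ _ _)
      rw [inv_mul_eq_div, le_div_iff₀ (by positivity)]
      calc _ ≤ cf PP k a * cf PP l b * cf PP m c *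
            (q ^ min (link PP a b) h + q ^ min (link PP a c) h) :=
            mul_le_mul_of_nonneg_left hle hc0
        _ = _ := by ring
    · rw [add_right_comm a c b, if_neg h0, if_neg h0, if_neg h0]
      simp
  have h3 : ∑ a ∈ arc PP h, ∑ b ∈ arc PP h, ∑ c ∈ arc PP h,
      (if a + c + b = 0 then cf PP k a * cf PP m c * q ^ min (link PP a c) h * cf PP l b else 0) =
      ∑ a ∈ arc PP h, ∑ c ∈ arc PP h, ∑ b ∈ arc PP h,
      (if a + c + b = 0 then cf PP k a * cf PP m c * q ^ min (link PP a c) h * cf PP l b else 0) :=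
    Finset.sum_congr rfl fun a _ => Finset.sum_comm
  rw [← h3] at h2
  refine (Finset.sum_le_sum fun a ha => Finset.sum_le_sum fun b hb => Finset.sum_le_sum fun c hc =>
    key a ha b hb c hc).trans ?_
  simp_rw [← Finset.mul_sum, Finset.sum_add_distrib]
  refine (mul_le_mul_of_nonneg_left (add_le_add h1 h2) (by positivity)).trans (le_of_eq ?_)
  rw [show k * m + (k + m + k * m) * l = k * l + k * m + l * m + k * l * m by ring,
    show k * l + (k + l + k * l) * m = k * l + k * m + l * m + k * l * m by ring]
  ring

theorem sum_five_rotate {α : Type*} (M : Finset α) (F : α → α → α → α → α → ℝ) :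
    ∑ a ∈ M, ∑ b ∈ M, ∑ c ∈ M, ∑ d ∈ M, ∑ e ∈ M, F b c d e a =
      ∑ a ∈ M, ∑ b ∈ M, ∑ c ∈ M, ∑ d ∈ M, ∑ e ∈ M, F a b c d e := by
  rw [Finset.sum_comm]
  refine Finset.sum_congr rfl fun a _ => ?_
  rw [Finset.sum_comm]
  refine Finset.sum_congr rfl fun b _ => ?_
  rw [Finset.sum_comm]
  refine Finset.sum_congr rfl fun c _ => ?_
  rw [Finset.sum_comm]

theorem sum_five_reorder {α : Type*} (M : Finset α) (F : α → α → α → α → α → ℝ) :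
    ∑ a ∈ M, ∑ b ∈ M, ∑ c ∈ M, ∑ d ∈ M, ∑ e ∈ M, F a b c d e =
      ∑ a ∈ M, ∑ b ∈ M, ∑ e ∈ M, ∑ c ∈ M, ∑ d ∈ M, F a b c d e := by
  refine Finset.sum_congr rfl fun a _ => Finset.sum_congr rfl fun b _ => ?_
  rw [Finset.sum_comm (s := M) (t := M) (f := fun e c => ∑ d ∈ M, F a b c d e)]
  exact Finset.sum_congr rfl fun c _ => Finset.sum_comm

/-- The complete graph on five fractions with sum zero is a union of five matchings with two edges,
and one of these matchings carries total weight at least `h`. -/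
theorem exists_matching {PP : Finset K[X]} (hP : IsPrimeSet PP) {h : ℕ} {a b c d e : K[X]}
    (ha : a ∈ arc PP h) (hb : b ∈ arc PP h) (hc : c ∈ arc PP h) (hd : d ∈ arc PP h)
    (he : e ∈ arc PP h) (h0 : a + b + c + d + e = 0) :
    h ≤ link PP b e + link PP c d ∨ h ≤ link PP c a + link PP d e ∨
    h ≤ link PP d b + link PP e a ∨ h ≤ link PP e c + link PP a b ∨
    h ≤ link PP a d + link PP b c := by
  have key : ∀ v w x y z : K[X], v ∈ arc PP h → v + w + x + y + z = 0 →
      2 * h ≤ link PP v w + link PP v x + link PP v y + link PP v z := by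
    intro v w x y z hv hs
    have h1 := two_mul_wt_supp_le (PP := PP) Finset.univ v ![w, x, y, z]
      (by simpa [Fin.sum_univ_four, add_assoc] using hs)
    simp [Fin.sum_univ_four] at h1
    have h2 := lt_wt_supp hP hv
    omega
  have h1 := key a b c d e ha h0
  have h2 := key b a c d e hb (by rw [← h0]; ring)
  have h3 := key c a b d e hc (by rw [← h0]; ring)
  have h4 := key d a b c e hd (by rw [← h0]; ring)
  have h5 := key e a b c d he (by rw [← h0]; ring)
  rw [link_comm PP b a] at h2
  rw [link_comm PP c b, link_comm PP c a] at h3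
  rw [link_comm PP d a, link_comm PP d b, link_comm PP d c] at h4
  rw [link_comm PP e a, link_comm PP e b, link_comm PP e c, link_comm PP e d] at h5
  rw [link_comm PP c a, link_comm PP d b, link_comm PP e a, link_comm PP e c]
  omega

/-- A weight that is at least `1` when the pairs `(b, e)` and `(c, d)` have large common parts in
total: sums zero are counted separately. -/
def matchWt (PP : Finset K[X]) (h : ℕ) (b e c d : K[X]) : ℝ :=
  (if b + e = 0 then 1 else 0) + (if c + d = 0 then 1 else 0) +
    (if b + e ≠ 0 then (if c + d ≠ 0 then (Fintype.card K : ℝ) ^ min (link PP b e) h *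
      (Fintype.card K : ℝ) ^ min (link PP c d) h * ((Fintype.card K : ℝ) ^ h)⁻¹ else 0) else 0)

theorem matchWt_nonneg (PP : Finset K[X]) (h : ℕ) (b e c d : K[X]) : 0 ≤ matchWt PP h b e c d := by
  have hq := q_pos (K := K)
  unfold matchWt
  refine add_nonneg (add_nonneg ?_ ?_) ?_ <;> split_ifs <;> positivity

theorem one_le_matchWt {PP : Finset K[X]} {h : ℕ} {b e c d : K[X]}
    (hl : h ≤ link PP b e + link PP c d) : 1 ≤ matchWt PP h b e c d := by
  have hq := q_pos (K := K)
  unfold matchWt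
  by_cases h2 : b + e = 0
  · rw [if_pos h2, if_neg (not_not.2 h2)]
    split_ifs <;> norm_num
  by_cases h3 : c + d = 0
  · rw [if_neg h2, if_pos h3, if_neg (not_not.2 h3)]
    simp
  rw [if_neg h2, if_neg h3, if_pos h2, if_pos h3, add_zero, zero_add, ← div_eq_mul_inv,
    one_le_div (by positivity), ← pow_add]
  exact pow_le_pow_right₀ one_lt_q.le (by omega)

/-! ### Quintuples with sum zero -/

theorem sum_four_swap {α : Type*} (M : Finset α) (F : α → α → α → α → ℝ) :
    ∑ b ∈ M, ∑ e ∈ M, ∑ c ∈ M, ∑ d ∈ M, F b e c d =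
      ∑ c ∈ M, ∑ d ∈ M, ∑ b ∈ M, ∑ e ∈ M, F b e c d := by
  calc _ = ∑ b ∈ M, ∑ c ∈ M, ∑ e ∈ M, ∑ d ∈ M, F b e c d :=
        Finset.sum_congr rfl fun b _ => Finset.sum_comm
    _ = ∑ c ∈ M, ∑ b ∈ M, ∑ e ∈ M, ∑ d ∈ M, F b e c d := Finset.sum_comm
    _ = ∑ c ∈ M, ∑ b ∈ M, ∑ d ∈ M, ∑ e ∈ M, F b e c d :=
        Finset.sum_congr rfl fun c _ => Finset.sum_congr rfl fun b _ => Finset.sum_comm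
    _ = _ := Finset.sum_congr rfl fun c _ => Finset.sum_comm

/-- Pairs with sum zero. -/
theorem sum_pairs_zero_le {PP : Finset K[X]} (hP : IsPrimeSet PP) (h : ℕ) :
    ∑ c ∈ arc PP h, ∑ d ∈ arc PP h, (if c + d = 0 then cf PP 1 c * cf PP 1 d else 0) ≤
      ((Fintype.card K : ℝ) ^ h)⁻¹ * eulerZ PP := by
  have h1 := sum_cf_mul_cf_le hP 1 1 h
  rw [mul_one, pow_one] at h1
  refine le_trans (le_of_eq (Finset.sum_congr rfl fun c hc => ?_)) h1
  rw [Finset.sum_eq_single (-c)]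
  · rw [add_neg_cancel, if_pos rfl, cf_neg]
  · intro d _ hd
    rw [if_neg]
    intro h2
    exact hd (eq_neg_of_add_eq_zero_right h2)
  · intro hc'
    exact absurd (neg_mem_arc hc) hc'

/-- The contribution of quintuples in which two members add up to zero. -/
theorem sum_quintuple_zero_pair_le {PP : Finset K[X]} (hP : IsPrimeSet PP) (h : ℕ) :
    ∑ a ∈ arc PP h, ∑ b ∈ arc PP h, ∑ e ∈ arc PP h, ∑ c ∈ arc PP h, ∑ d ∈ arc PP h,
      (if a + b + e + (c + d) = 0 ∧ c + d = 0 then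
        cf PP 1 a * cf PP 1 b * cf PP 1 e * (cf PP 1 c * cf PP 1 d) else 0) ≤
      (∑ a ∈ arc PP h, ∑ b ∈ arc PP h, ∑ e ∈ arc PP h,
        (if a + b + e = 0 then cf PP 1 a * cf PP 1 b * cf PP 1 e else 0)) *
      (((Fintype.card K : ℝ) ^ h)⁻¹ * eulerZ PP) := by
  simp_rw [Finset.sum_mul]
  refine Finset.sum_le_sum fun a _ => Finset.sum_le_sum fun b _ => Finset.sum_le_sum fun e _ => ?_
  have h1 : ∑ c ∈ arc PP h, ∑ d ∈ arc PP h, (if a + b + e + (c + d) = 0 ∧ c + d = 0 then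
      cf PP 1 a * cf PP 1 b * cf PP 1 e * (cf PP 1 c * cf PP 1 d) else 0) =
      (if a + b + e = 0 then cf PP 1 a * cf PP 1 b * cf PP 1 e else 0) *
      ∑ c ∈ arc PP h, ∑ d ∈ arc PP h, (if c + d = 0 then cf PP 1 c * cf PP 1 d else 0) := by
    simp_rw [Finset.mul_sum]
    refine Finset.sum_congr rfl fun c _ => Finset.sum_congr rfl fun d _ => ?_
    by_cases h2 : c + d = 0
    · rw [h2, add_zero]
      by_cases h3 : a + b + e = 0 <;> simp [h3]
    · simp [h2]
  rw [h1]
  refine mul_le_mul_of_nonneg_left (sum_pairs_zero_le hP h) ?_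
  split_ifs
  · exact mul_nonneg (mul_nonneg (cf_nonneg _ _ _) (cf_nonneg _ _ _)) (cf_nonneg _ _ _)
  · exact le_rfl

/-- The contribution of quintuples in which neither pair of the matching adds up to zero: each pair
is replaced by its sum, which leaves a sum over triples. -/
theorem exists_sum_quintuple_pairs_le {ε : ℝ} (hε : 0 < ε) :
    ∃ A : ℝ, 0 < A ∧ ∀ PP : Finset K[X], IsPrimeSet PP → ∀ h : ℕ,
      ∑ a ∈ arc PP h, ∑ b ∈ arc PP h, ∑ e ∈ arc PP h, ∑ c ∈ arc PP h, ∑ d ∈ arc PP h,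
        (if b + e ≠ 0 then (if c + d ≠ 0 then (if a + (b + e) + (c + d) = 0 then cf PP 1 a *
          (cf PP 1 b * cf PP 1 e * (Fintype.card K : ℝ) ^ min (link PP b e) h) *
          (cf PP 1 c * cf PP 1 d * (Fintype.card K : ℝ) ^ min (link PP c d) h)
          else 0) else 0) else 0) ≤
      A * ((Fintype.card K : ℝ) ^ h) ^ ε * ((Fintype.card K : ℝ) ^ h)⁻¹ ^ 2 * eulerZ PP ^ 26 := by
  obtain ⟨A, hA, hpair⟩ := exists_pairSum_le (K := K) 1 1 (ε := ε / 3) (by positivity)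
  obtain ⟨B, hB, htrip⟩ := exists_tripleSum_le (K := K) 1 3 3 (ε := ε / 3) (by positivity)
  refine ⟨A ^ 2 * B, by positivity, fun PP hP h => ?_⟩
  have hq := q_pos (K := K)
  have hZ : 0 ≤ eulerZ PP := zero_le_one.trans (one_le_eulerZ hP)
  specialize hpair PP hP h
  specialize htrip PP hP h
  norm_num at hpair htrip
  set q : ℝ := (Fintype.card K : ℝ) with hqdef
  set w : K[X] → K[X] → ℝ := fun b e => cf PP 1 b * cf PP 1 e * q ^ min (link PP b e) h with hw
  set R := A * (q ^ h) ^ (ε / 3) * eulerZ PP with hR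
  have hR0 : 0 ≤ R := by positivity
  have hw0 : ∀ b e, 0 ≤ w b e := fun b e =>
    mul_nonneg (mul_nonneg (cf_nonneg _ _ _) (cf_nonneg _ _ _)) (by positivity)
  -- For a function `G ≥ 0` of the sum, a pair may be replaced by its sum.
  have hrep : ∀ G : K[X] → ℝ, (∀ β, 0 ≤ G β) →
      ∑ b ∈ arc PP h, ∑ e ∈ arc PP h, (if b + e ≠ 0 then w b e * G (b + e) else 0) ≤
      ∑ β ∈ arc PP h, R * cf PP 3 β * G β := by
    intro G hG
    rw [sum_pairs_eq]
    exact Finset.sum_le_sum fun β _ => mul_le_mul_of_nonneg_right (hpair β) (hG β)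
  have h1 : ∀ a ∈ arc PP h, ∑ b ∈ arc PP h, ∑ e ∈ arc PP h, ∑ c ∈ arc PP h, ∑ d ∈ arc PP h,
      (if b + e ≠ 0 then (if c + d ≠ 0 then (if a + (b + e) + (c + d) = 0 then
        cf PP 1 a * w b e * w c d else 0) else 0) else 0) ≤
      ∑ β ∈ arc PP h, ∑ γ ∈ arc PP h, R ^ 2 *
        (if a + β + γ = 0 then cf PP 1 a * cf PP 3 β * cf PP 3 γ else 0) := by
    intro a _
    set G : K[X] → ℝ := fun β => ∑ γ ∈ arc PP h, R * cf PP 3 γ *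
      (if a + β + γ = 0 then cf PP 1 a else 0) with hG
    have hG0 : ∀ β, 0 ≤ G β := fun β => Finset.sum_nonneg fun γ _ =>
      mul_nonneg (mul_nonneg hR0 (cf_nonneg _ _ _)) (by split_ifs <;> [exact cf_nonneg _ _ _; rfl])
    refine le_trans (Finset.sum_le_sum fun b _ => Finset.sum_le_sum fun e _ => ?_)
      ((hrep G hG0).trans (le_of_eq ?_))
    · by_cases hbe : b + e ≠ 0
      · simp only [if_pos hbe]
        refine le_trans (le_of_eq ?_) (mul_le_mul_of_nonneg_left (hrep
          (fun γ => if a + (b + e) + γ = 0 then cf PP 1 a else 0)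
          (fun γ => by split_ifs <;> [exact cf_nonneg _ _ _; rfl])) (hw0 b e))
        simp_rw [Finset.mul_sum]
        refine Finset.sum_congr rfl fun c _ => Finset.sum_congr rfl fun d _ => ?_
        split_ifs <;> ring
      · simp only [if_neg hbe, Finset.sum_const_zero]
        exact le_rfl
    · refine Finset.sum_congr rfl fun β _ => ?_
      rw [hG, Finset.mul_sum]
      refine Finset.sum_congr rfl fun γ _ => ?_
      split_ifs <;> ring
  refine (Finset.sum_le_sum h1).trans ?_
  simp_rw [← Finset.mul_sum]
  refine (mul_le_mul_of_nonneg_left htrip (by positivity)).trans (le_of_eq ?_)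
  have h3 : (q ^ h) ^ ε = (q ^ h) ^ (ε / 3) * (q ^ h) ^ (ε / 3) * (q ^ h) ^ (ε / 3) := by
    rw [← Real.rpow_add (by positivity), ← Real.rpow_add (by positivity)]
    congr 1
    ring
  rw [h3, hR]
  ring

/-- The sum over quintuples of fractions with sum zero. -/
theorem exists_quintupleSum_le {ε : ℝ} (hε : 0 < ε) :
    ∃ A : ℝ, 0 < A ∧ ∀ PP : Finset K[X], IsPrimeSet PP → ∀ h : ℕ,
      ∑ a ∈ arc PP h, ∑ b ∈ arc PP h, ∑ c ∈ arc PP h, ∑ d ∈ arc PP h, ∑ e ∈ arc PP h,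
        (if a + b + c + d + e = 0 then
          cf PP 1 a * cf PP 1 b * cf PP 1 c * cf PP 1 d * cf PP 1 e else 0) ≤
      A * ((Fintype.card K : ℝ) ^ h) ^ ε * ((Fintype.card K : ℝ) ^ h)⁻¹ ^ 3 * eulerZ PP ^ 26 := by
  obtain ⟨A, hA, hpairs⟩ := exists_sum_quintuple_pairs_le (K := K) hε
  obtain ⟨B, hB, htrip⟩ := exists_tripleSum_le (K := K) 1 1 1 hε
  refine ⟨5 * (2 * B + A), by positivity, fun PP hP h => ?_⟩
  have hq := q_pos (K := K)
  have hZ1 := one_le_eulerZ hP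
  have hZ : 0 ≤ eulerZ PP := zero_le_one.trans hZ1
  specialize hpairs PP hP h
  specialize htrip PP hP h
  have hzero := sum_quintuple_zero_pair_le hP h
  set q : ℝ := (Fintype.card K : ℝ) with hqdef
  set F : K[X] → K[X] → K[X] → K[X] → K[X] → ℝ := fun a b c d e => if a + b + c + d + e = 0 then
    cf PP 1 a * cf PP 1 b * cf PP 1 c * cf PP 1 d * cf PP 1 e else 0 with hF
  have hF0 : ∀ a b c d e, 0 ≤ F a b c d e := by
    intro a b c d e
    simp only [hF]
    split_ifs
    · have := cf_nonneg PP 1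
      exact mul_nonneg (mul_nonneg (mul_nonneg (mul_nonneg (this _) (this _)) (this _)) (this _))
        (this _)
    · exact le_rfl
  have hFrot : ∀ a b c d e, F b c d e a = F a b c d e := by
    intro a b c d e
    simp only [hF]
    rw [show b + c + d + e + a = a + b + c + d + e by ring]
    split_ifs <;> ring
  set G : K[X] → K[X] → K[X] → K[X] → K[X] → ℝ := fun a b c d e =>
    F a b c d e * matchWt PP h b e c d with hG
  have hle : ∀ a ∈ arc PP h, ∀ b ∈ arc PP h, ∀ c ∈ arc PP h, ∀ d ∈ arc PP h, ∀ e ∈ arc PP h,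
      F a b c d e ≤ G a b c d e + G b c d e a + G c d e a b + G d e a b c + G e a b c d := by
    intro a ha b hb c hc d hd e he
    have e1 : G b c d e a = F a b c d e * matchWt PP h c a d e := by simp only [hG, hFrot]
    have e2 : G c d e a b = F a b c d e * matchWt PP h d b e a := by simp only [hG, hFrot]
    have e3 : G d e a b c = F a b c d e * matchWt PP h e c a b := by simp only [hG, hFrot]
    have e4 : G e a b c d = F a b c d e * matchWt PP h a d b c := by
      simp only [hG]
      rw [← hFrot e a b c d]
    rw [e1, e2, e3, e4]
    simp only [hG]
    rw [← mul_add, ← mul_add, ← mul_add, ← mul_add]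
    by_cases h0 : a + b + c + d + e = 0
    · refine le_mul_of_one_le_right (hF0 _ _ _ _ _) ?_
      have n1 := matchWt_nonneg PP h b e c d
      have n2 := matchWt_nonneg PP h c a d e
      have n3 := matchWt_nonneg PP h d b e a
      have n4 := matchWt_nonneg PP h e c a b
      have n5 := matchWt_nonneg PP h a d b c
      rcases exists_matching hP ha hb hc hd he h0 with hm | hm | hm | hm | hm <;>
      · have := one_le_matchWt hm
        linarith
    · have : F a b c d e = 0 := if_neg h0
      rw [this, zero_mul]
  have hGsum : ∑ a ∈ arc PP h, ∑ b ∈ arc PP h, ∑ c ∈ arc PP h, ∑ d ∈ arc PP h, ∑ e ∈ arc PP h,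
      F a b c d e ≤
      5 * ∑ a ∈ arc PP h, ∑ b ∈ arc PP h, ∑ c ∈ arc PP h, ∑ d ∈ arc PP h, ∑ e ∈ arc PP h,
        G a b c d e := by
    refine (Finset.sum_le_sum fun a ha => Finset.sum_le_sum fun b hb => Finset.sum_le_sum
      fun c hc => Finset.sum_le_sum fun d hd => Finset.sum_le_sum fun e he =>
        hle a ha b hb c hc d hd e he).trans (le_of_eq ?_)
    simp_rw [Finset.sum_add_distrib]
    rw [sum_five_rotate (arc PP h) G,
      sum_five_rotate (arc PP h) (fun b c d e a => G c d e a b), sum_five_rotate (arc PP h) G,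
      sum_five_rotate (arc PP h) (fun b c d e a => G d e a b c),
      sum_five_rotate (arc PP h) (fun b c d e a => G c d e a b), sum_five_rotate (arc PP h) G,
      ← sum_five_rotate (arc PP h) (fun a b c d e => G e a b c d)]
    ring
  refine hGsum.trans ?_
  rw [sum_five_reorder]
  have hsplit : ∀ a b e c d, G a b c d e =
      (if a + b + e + (c + d) = 0 ∧ c + d = 0 then
        cf PP 1 a * cf PP 1 b * cf PP 1 e * (cf PP 1 c * cf PP 1 d) else 0) +
      (if a + c + d + (b + e) = 0 ∧ b + e = 0 then
        cf PP 1 a * cf PP 1 c * cf PP 1 d * (cf PP 1 b * cf PP 1 e) else 0) +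
      (q ^ h)⁻¹ * (if b + e ≠ 0 then (if c + d ≠ 0 then (if a + (b + e) + (c + d) = 0 then
        cf PP 1 a * (cf PP 1 b * cf PP 1 e * q ^ min (link PP b e) h) *
          (cf PP 1 c * cf PP 1 d * q ^ min (link PP c d) h) else 0) else 0) else 0) := by
    intro a b e c d
    simp only [hG, hF, matchWt]
    rw [show a + b + e + (c + d) = a + b + c + d + e by ring,
      show a + c + d + (b + e) = a + b + c + d + e by ring,
      show a + (b + e) + (c + d) = a + b + c + d + e by ring]
    by_cases h0 : a + b + c + d + e = 0
    · by_cases h1 : b + e = 0 <;> by_cases h2 : c + d = 0 <;> simp [h0, h1, h2] <;> ring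
    · simp [h0]
  simp_rw [hsplit, Finset.sum_add_distrib, ← Finset.mul_sum]
  have hswap : ∑ a ∈ arc PP h, ∑ b ∈ arc PP h, ∑ e ∈ arc PP h, ∑ c ∈ arc PP h, ∑ d ∈ arc PP h,
      (if a + c + d + (b + e) = 0 ∧ b + e = 0 then
        cf PP 1 a * cf PP 1 c * cf PP 1 d * (cf PP 1 b * cf PP 1 e) else 0) =
      ∑ a ∈ arc PP h, ∑ c ∈ arc PP h, ∑ d ∈ arc PP h, ∑ b ∈ arc PP h, ∑ e ∈ arc PP h,
      (if a + c + d + (b + e) = 0 ∧ b + e = 0 then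
        cf PP 1 a * cf PP 1 c * cf PP 1 d * (cf PP 1 b * cf PP 1 e) else 0) := by
    exact Finset.sum_congr rfl fun a _ => sum_four_swap _ _
  rw [hswap]
  have hB' : (B * (q ^ h) ^ ε * (q ^ h)⁻¹ ^ 2 * eulerZ PP ^ (1 * 1 + 1 * 1 + 1 * 1 + 1 * 1 * 1)) *
      ((q ^ h)⁻¹ * eulerZ PP) ≤ B * (q ^ h) ^ ε * (q ^ h)⁻¹ ^ 3 * eulerZ PP ^ 26 := by
    calc _ = B * (q ^ h) ^ ε * (q ^ h)⁻¹ ^ 3 * eulerZ PP ^ 5 := by ring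
      _ ≤ _ := mul_le_mul_of_nonneg_left (pow_le_pow_right₀ hZ1 (by norm_num)) (by positivity)
  have hz := (hzero.trans (mul_le_mul_of_nonneg_right htrip (by positivity))).trans hB'
  have hp := mul_le_mul_of_nonneg_left hpairs (show 0 ≤ (q ^ h)⁻¹ by positivity)
  calc _ ≤ 5 * (B * (q ^ h) ^ ε * (q ^ h)⁻¹ ^ 3 * eulerZ PP ^ 26 +
        B * (q ^ h) ^ ε * (q ^ h)⁻¹ ^ 3 * eulerZ PP ^ 26 +
        (q ^ h)⁻¹ * (A * (q ^ h) ^ ε * (q ^ h)⁻¹ ^ 2 * eulerZ PP ^ 26)) :=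
        mul_le_mul_of_nonneg_left (add_le_add (add_le_add hz hz) hp) (by norm_num)
    _ = _ := by ring

/-! ### Fourier analysis modulo a squarefree polynomial -/

/-- The additive character `F ↦ ψ (F / Q)` of `K[X]` that is trivial on multiples of `Q`: the value
of `ψ` at the coefficient of `X⁻¹` in `F / Q`. -/
def eChar (ψ : AddChar K ℂ) (Q F : K[X]) : ℂ := ψ ((F %ₘ Q).coeff (Q.natDegree - 1))

theorem eChar_add (ψ : AddChar K ℂ) (Q F G : K[X]) :
    eChar ψ Q (F + G) = eChar ψ Q F * eChar ψ Q G := by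
  rw [eChar, eChar, eChar, add_modByMonic, coeff_add, AddChar.map_add_eq_mul]

theorem eChar_zero (ψ : AddChar K ℂ) (Q : K[X]) : eChar ψ Q 0 = 1 := by
  simp [eChar]

theorem eChar_of_degree_lt (ψ : AddChar K ℂ) {Q F : K[X]} (hQ : Q.Monic)
    (hF : F.degree < Q.degree) : eChar ψ Q F = ψ (F.coeff (Q.natDegree - 1)) := by
  rw [eChar, (modByMonic_eq_self_iff hQ).2 hF]

/-- Orthogonality over the polynomials of degree less than `m`. -/
theorem sum_eChar {ψ : AddChar K ℂ} (hψ : ψ ≠ 1) {Q : K[X]} (hQ : Q.Monic) {B : K[X]}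
    (hB : B ∈ polyLT K Q.natDegree) (m : ℕ) :
    ∑ J ∈ polyLT K m, eChar ψ Q (B * J) =
      if B ∈ polyLT K (Q.natDegree - m) then (Fintype.card K : ℂ) ^ m else 0 := by
  split_ifs with hBm
  · have h1 : ∀ J ∈ polyLT K m, eChar ψ Q (B * J) = 1 := by
      intro J hJ
      by_cases h0 : B * J = 0
      · rw [h0, eChar_zero]
      have hB0 := left_ne_zero_of_mul h0
      have hJ0 := right_ne_zero_of_mul h0
      rw [mem_polyLT_iff hB0] at hBm
      rw [mem_polyLT_iff hJ0] at hJ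
      have hd := natDegree_mul hB0 hJ0
      rw [eChar_of_degree_lt ψ hQ, coeff_eq_zero_of_natDegree_lt, AddChar.map_zero_eq_one]
      · omega
      · exact degree_lt_degree (by omega)
    rw [Finset.sum_congr rfl h1, Finset.sum_const, card_polyLT, nsmul_eq_mul, mul_one]
    push_cast
    rfl
  · have hB0 : B ≠ 0 := by
      rintro rfl
      exact hBm (zero_mem_polyLT _)
    rw [mem_polyLT_iff hB0] at hB hBm
    obtain ⟨t, ht⟩ := AddChar.ne_one_iff.1 hψ
    set J₀ : K[X] := C (t / B.leadingCoeff) * X ^ (Q.natDegree - 1 - B.natDegree) with hJ₀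
    have hdJ : J₀.natDegree ≤ Q.natDegree - 1 - B.natDegree := natDegree_C_mul_X_pow_le _ _
    have hJ₀m : J₀ ∈ polyLT K m := by
      by_cases h0 : J₀ = 0
      · rw [h0]; exact zero_mem_polyLT _
      · rw [mem_polyLT_iff h0]
        omega
    have he : eChar ψ Q (B * J₀) ≠ 1 := by
      have hd : (B * J₀).natDegree < Q.natDegree := by
        have := natDegree_mul_le (p := B) (q := J₀)
        omega
      rw [eChar_of_degree_lt ψ hQ (degree_lt_degree hd)]
      have hc : (B * J₀).coeff (Q.natDegree - 1) = t := by
        rw [show Q.natDegree - 1 = B.natDegree + (Q.natDegree - 1 - B.natDegree) by omega,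
          coeff_mul_add_eq_of_natDegree_le le_rfl hdJ, hJ₀, coeff_C_mul_X_pow, if_pos rfl,
          coeff_natDegree, mul_div_cancel₀ _ (leadingCoeff_ne_zero.2 hB0)]
      rwa [hc]
    have hshift : ∑ J ∈ polyLT K m, eChar ψ Q (B * J) =
        ∑ J ∈ polyLT K m, eChar ψ Q (B * J) * eChar ψ Q (B * J₀) := by
      refine Finset.sum_nbij' (fun J => J - J₀) (fun J => J + J₀) ?_ ?_ ?_ ?_ ?_
      · exact fun J hJ => sub_mem_polyLT hJ hJ₀m
      · exact fun J hJ => add_mem_polyLT hJ hJ₀m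
      · exact fun J _ => sub_add_cancel J J₀
      · exact fun J _ => add_sub_cancel_right J J₀
      · intro J _
        rw [← eChar_add, ← mul_add, sub_add_cancel]
    rw [← Finset.sum_mul] at hshift
    have h2 : (∑ J ∈ polyLT K m, eChar ψ Q (B * J)) * (eChar ψ Q (B * J₀) - 1) = 0 := by
      rw [mul_sub, mul_one, ← hshift, sub_self]
    exact (mul_eq_zero.1 h2).resolve_right (sub_ne_zero.2 he)

theorem eChar_mul_mul (ψ : AddChar K ℂ) {V W : K[X]} (hV : V.Monic) (hW : W.Monic) (F : K[X]) :
    eChar ψ (V * W) (V * F) = eChar ψ W F := by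
  have h1 : (V * F) %ₘ (V * W) = V * (F %ₘ W) := by
    refine (div_modByMonic_unique (F /ₘ W) (V * (F %ₘ W)) (hV.mul hW) ⟨?_, ?_⟩).2
    · rw [mul_assoc, ← mul_add, modByMonic_add_div]
    · rw [degree_mul, degree_mul]
      exact WithBot.add_lt_add_left (degree_ne_bot.2 hV.ne_zero) (degree_modByMonic_lt F hW)
  rw [eChar, eChar, h1, natDegree_mul hV.ne_zero hW.ne_zero]
  rcases Nat.eq_zero_or_pos W.natDegree with h0 | hpos
  · rw [hW.natDegree_eq_zero.1 h0]
    simp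
  · rw [show V.natDegree + W.natDegree - 1 = V.natDegree + (W.natDegree - 1) by omega,
      coeff_mul_add_eq_of_natDegree_le le_rfl, hV.coeff_natDegree, one_mul]
    have := natDegree_modByMonic_lt F hW (by rintro rfl; simp at hpos)
    omega

/-- Orthogonality over the multiples of a divisor `V` of the modulus `V * W`. -/
theorem sum_eChar_multiples {ψ : AddChar K ℂ} (hψ : ψ ≠ 1) {V W : K[X]} (hV : V.Monic)
    (hW : W.Monic) (G : K[X]) :
    ∑ B ∈ (polyLT K (V * W).natDegree).filter (fun B => V ∣ B), eChar ψ (V * W) (B * G) =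
      if W ∣ G then (Fintype.card K : ℂ) ^ W.natDegree else 0 := by
  have h1 : ∑ B ∈ (polyLT K (V * W).natDegree).filter (fun B => V ∣ B),
      eChar ψ (V * W) (B * G) = ∑ A ∈ polyLT K W.natDegree, eChar ψ W ((G %ₘ W) * A) := by
    symm
    refine Finset.sum_bij (fun A _ => V * A) ?_ ?_ ?_ ?_
    · intro A hA
      refine Finset.mem_filter.2 ⟨?_, dvd_mul_right _ _⟩
      by_cases h0 : A = 0
      · rw [h0, mul_zero]; exact zero_mem_polyLT _
      · rw [mem_polyLT_iff h0] at hA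
        rw [mem_polyLT_iff (mul_ne_zero hV.ne_zero h0), natDegree_mul hV.ne_zero h0,
          natDegree_mul hV.ne_zero hW.ne_zero]
        omega
    · intro A _ A' _ h
      exact mul_left_cancel₀ hV.ne_zero h
    · intro B hB
      obtain ⟨hB1, A, rfl⟩ := Finset.mem_filter.1 hB
      refine ⟨A, ?_, rfl⟩
      by_cases h0 : A = 0
      · rw [h0]; exact zero_mem_polyLT _
      · rw [mem_polyLT_iff (mul_ne_zero hV.ne_zero h0), natDegree_mul hV.ne_zero h0,
          natDegree_mul hV.ne_zero hW.ne_zero] at hB1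
        rw [mem_polyLT_iff h0]
        omega
    · intro A _
      rw [mul_assoc, eChar_mul_mul ψ hV hW, eChar, eChar]
      congr 2
      rw [mul_comm A G, mul_modByMonic G A, mul_modByMonic (G %ₘ W) A,
        (modByMonic_eq_self_iff hW).2 (degree_modByMonic_lt G hW)]
  have hG : G %ₘ W ∈ polyLT K W.natDegree := by
    rw [mem_polyLT, ← degree_eq_natDegree hW.ne_zero]
    exact degree_modByMonic_lt G hW
  rw [h1, sum_eChar hψ hW hG, Nat.sub_self]
  refine if_congr ?_ rfl rfl
  rw [← modByMonic_eq_zero_iff_dvd hW, mem_polyLT]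
  simp

/-- The Fourier coefficients of the indicator function of the polynomials prime to all of `PP`. -/
def fcoef (PP : Finset K[X]) (B : K[X]) : ℂ :=
  ∏ p ∈ PP, ((if p ∣ B then 1 else 0) + -((Fintype.card K : ℂ) ^ p.natDegree)⁻¹)

theorem norm_fcoef_le {PP : Finset K[X]} (hP : IsPrimeSet PP) (B : K[X]) :
    ‖fcoef PP B‖ ≤ cf PP 1 B := by
  rw [fcoef, norm_prod, cf, Nat.cast_one, one_pow, one_div, wt, ← Finset.prod_pow_eq_pow_sum,
    ← Finset.prod_inv_distrib, supp, Finset.prod_filter]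
  refine Finset.prod_le_prod (fun _ _ => norm_nonneg _) fun p hp => ?_
  have h1 := inv_q_pow_le (hP p hp).2
  have h2 : 0 < ((Fintype.card K : ℝ) ^ p.natDegree)⁻¹ := inv_pos.2 (pow_pos q_pos _)
  by_cases hd : p ∣ B
  · rw [if_pos hd, if_neg (not_not.2 hd)]
    have : (1 : ℂ) + -((Fintype.card K : ℂ) ^ p.natDegree)⁻¹ =
        ((1 - ((Fintype.card K : ℝ) ^ p.natDegree)⁻¹ : ℝ) : ℂ) := by push_cast; ring
    rw [this, Complex.norm_real, Real.norm_eq_abs, abs_le]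
    constructor <;> linarith
  · rw [if_neg hd, if_pos hd, zero_add, norm_neg]
    simp

theorem fcoef_zero (PP : Finset K[X]) : fcoef PP 0 = ((eulerZ PP)⁻¹ : ℝ) := by
  rw [fcoef, eulerZ, ← Finset.prod_inv_distrib]
  push_cast
  refine Finset.prod_congr rfl fun p _ => ?_
  simp [sub_eq_add_neg]

/-- The Fourier expansion of the indicator function of the polynomials prime to all of `PP`. -/
theorem sum_fcoef_mul_eChar {ψ : AddChar K ℂ} (hψ : ψ ≠ 1) {PP : Finset K[X]} (hP : IsPrimeSet PP)
    (G : K[X]) :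
    ∑ B ∈ polyLT K (wt PP), fcoef PP B * eChar ψ (∏ p ∈ PP, p) (B * G) =
      if ∀ p ∈ PP, ¬ p ∣ G then 1 else 0 := by
  have hexp : ∀ B : K[X], fcoef PP B = ∑ D ∈ PP.powerset, (if ∏ p ∈ D, p ∣ B then
      ∏ p ∈ PP \ D, (-((Fintype.card K : ℂ) ^ p.natDegree)⁻¹) else 0) := by
    intro B
    rw [fcoef, Finset.prod_add]
    refine Finset.sum_congr rfl fun D hD => ?_
    rw [Finset.prod_ite_zero, Finset.prod_const_one, ite_mul, one_mul, zero_mul]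
    refine if_congr ?_ rfl rfl
    rw [(hP.mono (Finset.mem_powerset.1 hD)).prod_dvd_iff]
  simp_rw [hexp, Finset.sum_mul]
  rw [Finset.sum_comm]
  have hD : ∀ D ∈ PP.powerset, ∑ B ∈ polyLT K (wt PP), (if ∏ p ∈ D, p ∣ B then
      ∏ p ∈ PP \ D, (-((Fintype.card K : ℂ) ^ p.natDegree)⁻¹) else 0) *
      eChar ψ (∏ p ∈ PP, p) (B * G) =
      (∏ p ∈ D, (1 : ℂ)) * ∏ p ∈ PP \ D, (if p ∣ G then -1 else 0) := by
    intro D hD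
    have hDP := Finset.mem_powerset.1 hD
    have h1 := hP.mono hDP
    have h2 := hP.mono (Finset.sdiff_subset (s := PP) (t := D))
    have hprod : ∏ p ∈ PP, p = (∏ p ∈ D, p) * ∏ p ∈ PP \ D, p := by
      rw [mul_comm, Finset.prod_sdiff hDP]
    have h3 := sum_eChar_multiples hψ h1.monic_prod h2.monic_prod G
    rw [← hprod, hP.natDegree_prod, h2.natDegree_prod, Finset.sum_filter] at h3
    simp_rw [ite_mul, zero_mul, ← mul_ite_zero]
    rw [← Finset.mul_sum, h3, Finset.prod_const_one, one_mul, Finset.prod_ite_zero, h2.prod_dvd_iff]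
    split_ifs with hG
    · rw [wt, ← Finset.prod_pow_eq_pow_sum, ← Finset.prod_mul_distrib]
      refine Finset.prod_congr rfl fun p _ => ?_
      have : (Fintype.card K : ℂ) ≠ 0 := by exact_mod_cast Fintype.card_ne_zero
      field_simp
    · rw [mul_zero]
  rw [Finset.sum_congr rfl hD, ← Finset.prod_add]
  have h4 : ∀ p ∈ PP, (1 : ℂ) + (if p ∣ G then -1 else 0) = if ¬ p ∣ G then 1 else 0 := by
    intro p _
    by_cases h : p ∣ G <;> simp [h]
  rw [Finset.prod_congr rfl h4, Finset.prod_ite_zero, Finset.prod_const_one]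

/-! ### The moment as a sum over fractions -/

theorem nrm_lt_iff {A : K[X]} {m : ℕ} : nrm A < (Fintype.card K : ℝ) ^ m ↔ A ∈ polyLT K m := by
  by_cases h0 : A = 0
  · rw [h0]
    simp [nrm, zero_mem_polyLT, pow_pos q_pos]
  · rw [nrm, if_neg h0, pow_lt_pow_iff_right₀ one_lt_q, mem_polyLT_iff h0]

theorem nrm_eq_pow {Q : K[X]} (hQ : Q ≠ 0) : nrm Q = (Fintype.card K : ℝ) ^ Q.natDegree := by
  rw [nrm, if_neg hQ]

theorem residues_eq {Q : K[X]} (hQ : Q ≠ 0) : residues Q = polyLT K Q.natDegree := by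
  ext A
  rw [residues, Set.Finite.mem_toFinset, Set.mem_ofPred_eq, nrm_eq_pow hQ, nrm_lt_iff]

theorem natDegree_of_associated {PP : Finset K[X]} (hP : IsPrimeSet PP) {Q : K[X]}
    (hQ : Associated Q (∏ p ∈ PP, p)) : Q.natDegree = wt PP := by
  rw [← hP.natDegree_prod, natDegree_eq_of_degree_eq (degree_eq_degree_of_associated hQ)]

theorem ne_zero_of_associated {PP : Finset K[X]} (hP : IsPrimeSet PP) {Q : K[X]}
    (hQ : Associated Q (∏ p ∈ PP, p)) : Q ≠ 0 :=
  hQ.ne_zero_iff.2 hP.monic_prod.ne_zero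

theorem isCoprime_iff {PP : Finset K[X]} (hP : IsPrimeSet PP) {Q : K[X]}
    (hQ : Associated Q (∏ p ∈ PP, p)) (G : K[X]) :
    IsCoprime G Q ↔ ∀ p ∈ PP, ¬ p ∣ G := by
  obtain ⟨u, hu⟩ := hQ
  have h1 : IsCoprime G Q ↔ IsCoprime G (∏ p ∈ PP, p) := by
    rw [← hu, isCoprime_mul_unit_right_right u.isUnit]
  rw [h1, IsCoprime.prod_right_iff]
  refine forall₂_congr fun p hp => ?_
  rw [isCoprime_comm, (hP p hp).2.coprime_iff_not_dvd]

theorem coprimeCount_eq_sum {PP : Finset K[X]} (hP : IsPrimeSet PP) {Q : K[X]}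
    (hQ : Associated Q (∏ p ∈ PP, p)) (F : K[X]) (h : ℕ) :
    (coprimeCount Q F h : ℂ) = ∑ J ∈ polyLT K h, if ∀ p ∈ PP, ¬ p ∣ F + J then 1 else 0 := by
  rw [coprimeCount, Finset.sum_boole]
  congr 1
  refine Finset.card_nbij' (fun G => G - F) (fun J => F + J) ?_ ?_ ?_ ?_
  · intro G hG
    rw [Finset.mem_coe, Finset.mem_filter, Set.Finite.mem_toFinset, interval, Set.mem_ofPred_eq,
      nrm_lt_iff, isCoprime_iff hP hQ] at hG
    rw [Finset.mem_coe, Finset.mem_filter, add_sub_cancel]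
    refine ⟨?_, hG.2⟩
    have := neg_mem_polyLT hG.1
    rwa [neg_sub] at this
  · intro J hJ
    rw [Finset.mem_coe, Finset.mem_filter] at hJ
    rw [Finset.mem_coe, Finset.mem_filter, Set.Finite.mem_toFinset, interval, Set.mem_ofPred_eq,
      nrm_lt_iff, isCoprime_iff hP hQ, sub_add_cancel_left]
    exact ⟨neg_mem_polyLT hJ.1, hJ.2⟩
  · intro G _
    exact add_sub_cancel F G
  · intro J _
    exact add_sub_cancel_left F J

/-- The Fourier expansion of the count over an interval: only fractions of norm less than
`q ^ (-h)` contribute. -/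
theorem coprimeCount_eq {ψ : AddChar K ℂ} (hψ : ψ ≠ 1) {PP : Finset K[X]} (hP : IsPrimeSet PP)
    {Q : K[X]} (hQ : Associated Q (∏ p ∈ PP, p)) (F : K[X]) (h : ℕ) :
    (coprimeCount Q F h : ℂ) = (Fintype.card K : ℂ) ^ h *
      ∑ B ∈ polyLT K (wt PP - h), fcoef PP B * eChar ψ (∏ p ∈ PP, p) (B * F) := by
  rw [coprimeCount_eq_sum hP hQ]
  simp_rw [← sum_fcoef_mul_eChar hψ hP]
  rw [Finset.sum_comm, Finset.mul_sum, ← Finset.sum_subset (polyLT_mono (Nat.sub_le (wt PP) h))]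
  · refine Finset.sum_congr rfl fun B hB => ?_
    have h1 := sum_eChar hψ hP.monic_prod (B := B)
      (by rw [hP.natDegree_prod]; exact polyLT_mono (Nat.sub_le _ _) hB) h
    rw [hP.natDegree_prod, if_pos hB] at h1
    simp_rw [mul_add, eChar_add]
    rw [← h1, Finset.sum_mul]
    exact Finset.sum_congr rfl fun J _ => by ring
  · intro B hB hB'
    have h1 := sum_eChar hψ hP.monic_prod (B := B) (by rwa [hP.natDegree_prod]) h
    rw [hP.natDegree_prod, if_neg hB'] at h1
    simp_rw [mul_add, eChar_add, ← mul_assoc]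
    rw [← Finset.mul_sum, h1, mul_zero]

theorem exists_addChar_ne_one : ∃ ψ : AddChar K ℂ, ψ ≠ 1 := by
  obtain ⟨ψ, hψ⟩ := AddChar.exists_apply_ne_zero.2 (one_ne_zero (α := K))
  exact ⟨ψ, AddChar.ne_one_iff.2 ⟨1, hψ⟩⟩

theorem phi_eq {PP : Finset K[X]} (hP : IsPrimeSet PP) {Q : K[X]}
    (hQ : Associated Q (∏ p ∈ PP, p)) :
    (phi Q : ℝ) = (Fintype.card K : ℝ) ^ wt PP * (eulerZ PP)⁻¹ := by
  obtain ⟨ψ, hψ⟩ := exists_addChar_ne_one (K := K)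
  have h1 : phi Q = coprimeCount Q 0 (wt PP) := by
    rw [phi, coprimeCount, residues_eq (ne_zero_of_associated hP hQ),
      natDegree_of_associated hP hQ]
    congr 2
    ext A
    rw [Set.Finite.mem_toFinset, interval, Set.mem_ofPred_eq, nrm_lt_iff, zero_sub]
    exact ⟨neg_mem_polyLT, fun hA => by simpa using neg_mem_polyLT hA⟩
  have h2 := coprimeCount_eq hψ hP hQ 0 (wt PP)
  have h3 : polyLT K (wt PP - wt PP) = {0} := by
    ext A
    rw [Nat.sub_self, mem_polyLT]
    simp
  rw [h3, Finset.sum_singleton, fcoef_zero, mul_zero, eChar_zero, mul_one, ← h1] at h2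
  exact_mod_cast h2

theorem sum_pow_five {α R : Type*} [CommRing R] (M : Finset α) (u : α → R) :
    (∑ a ∈ M, u a) ^ 5 = ∑ a ∈ M, ∑ b ∈ M, ∑ c ∈ M, ∑ d ∈ M, ∑ e ∈ M,
      u a * u b * u c * u d * u e := by
  simp only [← Finset.mul_sum, ← Finset.sum_mul]
  ring

theorem sum_comm_five {α R : Type*} [AddCommMonoid R] (N M : Finset α)
    (g : α → α → α → α → α → α → R) :
    ∑ x ∈ N, ∑ a ∈ M, ∑ b ∈ M, ∑ c ∈ M, ∑ d ∈ M, ∑ e ∈ M, g x a b c d e =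
      ∑ a ∈ M, ∑ b ∈ M, ∑ c ∈ M, ∑ d ∈ M, ∑ e ∈ M, ∑ x ∈ N, g x a b c d e := by
  rw [Finset.sum_comm]
  refine Finset.sum_congr rfl fun a _ => ?_
  rw [Finset.sum_comm]
  refine Finset.sum_congr rfl fun b _ => ?_
  rw [Finset.sum_comm]
  refine Finset.sum_congr rfl fun c _ => ?_
  rw [Finset.sum_comm]
  exact Finset.sum_congr rfl fun d _ => Finset.sum_comm

theorem sum_sum_pow_five {α R : Type*} [CommRing R] (N M : Finset α) (u : α → R)
    (v : α → α → R) :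
    ∑ x ∈ N, (∑ a ∈ M, u a * v x a) ^ 5 =
      ∑ a ∈ M, ∑ b ∈ M, ∑ c ∈ M, ∑ d ∈ M, ∑ e ∈ M, u a * u b * u c * u d * u e *
        ∑ x ∈ N, v x a * v x b * v x c * v x d * v x e := by
  rw [Finset.sum_congr rfl fun x _ => sum_pow_five M fun a => u a * v x a, sum_comm_five]
  simp_rw [Finset.mul_sum]
  exact Finset.sum_congr rfl fun a _ => Finset.sum_congr rfl fun b _ => Finset.sum_congr rfl
    fun c _ => Finset.sum_congr rfl fun d _ => Finset.sum_congr rfl fun e _ =>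
    Finset.sum_congr rfl fun x _ => by ring

/-- The fifth moment is bounded by a sum over quintuples of short fractions with sum zero. -/
theorem abs_moment_five_le {PP : Finset K[X]} (hP : IsPrimeSet PP) {Q : K[X]}
    (hQ : Associated Q (∏ p ∈ PP, p)) (h : ℕ) :
    |moment 5 Q h| ≤ (Fintype.card K : ℝ) ^ wt PP * ((Fintype.card K : ℝ) ^ h) ^ 5 *
      ∑ a ∈ arc PP h, ∑ b ∈ arc PP h, ∑ c ∈ arc PP h, ∑ d ∈ arc PP h, ∑ e ∈ arc PP h,
        (if a + b + c + d + e = 0 then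
          cf PP 1 a * cf PP 1 b * cf PP 1 c * cf PP 1 d * cf PP 1 e else 0) := by
  obtain ⟨ψ, hψ⟩ := exists_addChar_ne_one (K := K)
  have hq := q_pos (K := K)
  have hterm : ∀ F : K[X], (((coprimeCount Q F h : ℝ) -
      (Fintype.card K : ℝ) ^ h * (phi Q : ℝ) / nrm Q : ℝ) : ℂ) =
      (Fintype.card K : ℂ) ^ h * ∑ B ∈ arc PP h,
        fcoef PP B * eChar ψ (∏ p ∈ PP, p) (B * F) := by
    intro F
    have h1 : (Fintype.card K : ℝ) ^ h * (phi Q : ℝ) / nrm Q =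
        (Fintype.card K : ℝ) ^ h * (eulerZ PP)⁻¹ := by
      rw [phi_eq hP hQ, nrm_eq_pow (ne_zero_of_associated hP hQ), natDegree_of_associated hP hQ]
      field_simp
    rw [h1, Complex.ofReal_sub, Complex.ofReal_mul, ← fcoef_zero, Complex.ofReal_natCast,
      coprimeCount_eq hψ hP hQ, arc, ← Finset.add_sum_erase _ _ (zero_mem_polyLT (wt PP - h)),
      zero_mul, eChar_zero]
    push_cast
    ring
  have hM : ∀ a ∈ arc PP h, a ∈ polyLT K (wt PP) := fun a ha =>
    polyLT_mono (Nat.sub_le _ _) (mem_arc.1 ha).2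
  have hsum : ((moment 5 Q h : ℝ) : ℂ) = ((Fintype.card K : ℂ) ^ h) ^ 5 *
      ∑ a ∈ arc PP h, ∑ b ∈ arc PP h, ∑ c ∈ arc PP h, ∑ d ∈ arc PP h, ∑ e ∈ arc PP h,
        fcoef PP a * fcoef PP b * fcoef PP c * fcoef PP d * fcoef PP e *
        (if a + b + c + d + e = 0 then (Fintype.card K : ℂ) ^ wt PP else 0) := by
    rw [moment, Complex.ofReal_sum, residues_eq (ne_zero_of_associated hP hQ),
      natDegree_of_associated hP hQ]
    simp_rw [Complex.ofReal_pow, hterm, mul_pow]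
    rw [← Finset.mul_sum, sum_sum_pow_five]
    refine congrArg _ ?_
    refine Finset.sum_congr rfl fun a ha => Finset.sum_congr rfl fun b hb => Finset.sum_congr rfl
      fun c hc => Finset.sum_congr rfl fun d hd => Finset.sum_congr rfl fun e he => ?_
    have hS : a + b + c + d + e ∈ polyLT K (∏ p ∈ PP, p).natDegree := by
      rw [hP.natDegree_prod]
      exact add_mem_polyLT (add_mem_polyLT (add_mem_polyLT (add_mem_polyLT (hM a ha) (hM b hb))
        (hM c hc)) (hM d hd)) (hM e he)
    have h2 := sum_eChar hψ hP.monic_prod hS (wt PP)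
    rw [hP.natDegree_prod, Nat.sub_self] at h2
    have h3 : (if a + b + c + d + e = 0 then (Fintype.card K : ℂ) ^ wt PP else 0) =
        ∑ J ∈ polyLT K (wt PP), eChar ψ (∏ p ∈ PP, p) ((a + b + c + d + e) * J) := by
      rw [h2]
      refine if_congr ?_ rfl rfl
      rw [mem_polyLT]
      simp
    rw [h3]
    refine congrArg _ ?_
    refine Finset.sum_congr rfl fun J _ => ?_
    rw [add_mul, add_mul, add_mul, add_mul, eChar_add, eChar_add, eChar_add, eChar_add]
  rw [← Real.norm_eq_abs, ← Complex.norm_real, hsum, norm_mul, norm_pow, norm_pow,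
    Complex.norm_natCast, mul_comm ((Fintype.card K : ℝ) ^ wt PP), mul_assoc]
  refine mul_le_mul_of_nonneg_left ?_ (by positivity)
  simp_rw [Finset.mul_sum]
  refine norm_sum_le_of_le _ fun a _ => norm_sum_le_of_le _ fun b _ => norm_sum_le_of_le _ fun c _ =>
    norm_sum_le_of_le _ fun d _ => norm_sum_le_of_le _ fun e _ => ?_
  split_ifs
  · rw [norm_mul, norm_mul, norm_mul, norm_mul, norm_mul, norm_pow, Complex.norm_natCast, mul_comm]
    have hn := norm_fcoef_le hP
    gcongr <;> first | exact hn _ | exact cf_nonneg _ _ _ | skip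
    all_goals
      have hc := cf_nonneg PP 1
      have := hc a
      have := hc b
      have := hc c
      have := hc d
      positivity
  · simp

/-! ### Mertens' bound and the conclusion -/

theorem exists_primeSet_of_squarefree {Q : K[X]} (hQ : Squarefree Q) :
    ∃ PP : Finset K[X], IsPrimeSet PP ∧ Associated Q (∏ p ∈ PP, p) := by
  have h0 := hQ.ne_zero
  refine ⟨(UniqueFactorizationMonoid.normalizedFactors Q).toFinset, ?_, ?_⟩
  · intro p hp
    rw [Multiset.mem_toFinset] at hp
    have hirr := UniqueFactorizationMonoid.irreducible_of_normalized_factor p hp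
    refine ⟨?_, hirr⟩
    rw [← UniqueFactorizationMonoid.normalize_normalized_factor p hp]
    exact monic_normalize hirr.ne_zero
  · have hnd := (UniqueFactorizationMonoid.squarefree_iff_nodup_normalizedFactors h0).1 hQ
    rw [Finset.prod, Multiset.toFinset_val, Multiset.dedup_eq_self.2 hnd, Multiset.map_id']
    exact (UniqueFactorizationMonoid.prod_normalizedFactors h0).symm

theorem dvd_X_pow_sub_X {p : K[X]} (hp : Irreducible p) :
    p ∣ X ^ Fintype.card K ^ p.natDegree - X := by
  rw [← Nat.card_eq_fintype_card]
  exact hp.natDegree_dvd_iff_dvd_X_pow_card_pow_sub_X.1 dvd_rfl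

/-- The prime polynomial bound: at most `q ^ d / d` monic irreducible polynomials have
degree `d`. -/
theorem card_mul_le_of_natDegree_eq {D : Finset K[X]} (hD : IsPrimeSet D) {d : ℕ}
    (hd : ∀ p ∈ D, p.natDegree = d) : D.card * d ≤ Fintype.card K ^ d := by
  have hw : wt D = D.card * d := by
    rw [wt, Finset.sum_congr rfl hd, Finset.sum_const, smul_eq_mul]
  rcases Nat.eq_zero_or_pos d with rfl | hpos
  · simp
  have hX : (X ^ Fintype.card K ^ d - X : K[X]) ≠ 0 :=
    FiniteField.X_pow_card_pow_sub_X_ne_zero K hpos.ne' Fintype.one_lt_card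
  have hdvd : (∏ p ∈ D, p) ∣ (X ^ Fintype.card K ^ d - X : K[X]) := by
    rw [hD.prod_dvd_iff]
    intro p hp
    rw [← hd p hp]
    exact dvd_X_pow_sub_X (hD p hp).2
  have h1 := natDegree_le_of_dvd hdvd hX
  rwa [hD.natDegree_prod, hw,
    FiniteField.X_pow_card_pow_sub_X_natDegree_eq K hpos.ne' Fintype.one_lt_card] at h1

/-- Upper bound of Mertens type for the Euler product over the primes of degree at most `n`. -/
theorem eulerZ_le {PP : Finset K[X]} (hP : IsPrimeSet PP) {n : ℕ}
    (hn : ∀ p ∈ PP, p.natDegree ≤ n) : eulerZ PP ≤ Real.exp 2 * ((n : ℝ) + 1) ^ 2 := by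
  have hq := q_pos (K := K)
  have h1 : eulerZ PP ≤ Real.exp (2 * ∑ p ∈ PP, ((Fintype.card K : ℝ) ^ p.natDegree)⁻¹) := by
    rw [Finset.mul_sum, Real.exp_sum, eulerZ]
    refine Finset.prod_le_prod ?_ ?_
    · intro p hp
      have := inv_q_pow_le (hP p hp).2
      exact inv_nonneg.2 (by linarith)
    · intro p hp
      have h2 := inv_q_pow_le (hP p hp).2
      have h3 : 0 < ((Fintype.card K : ℝ) ^ p.natDegree)⁻¹ := by positivity
      set t := ((Fintype.card K : ℝ) ^ p.natDegree)⁻¹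
      refine le_trans ?_ (Real.add_one_le_exp (2 * t))
      rw [inv_le_iff_one_le_mul₀ (by linarith)]
      nlinarith
  have h2 : ∑ p ∈ PP, ((Fintype.card K : ℝ) ^ p.natDegree)⁻¹ ≤ ((harmonic n : ℚ) : ℝ) := by
    have hmaps : ∀ p ∈ PP, p.natDegree - 1 ∈ Finset.range n := by
      intro p hp
      have := (hP p hp).2.natDegree_pos
      have := hn p hp
      exact Finset.mem_range.2 (by omega)
    rw [← Finset.sum_fiberwise_of_maps_to hmaps, harmonic]
    push_cast
    refine Finset.sum_le_sum fun i _ => ?_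
    have hdeg : ∀ p ∈ PP.filter (fun p => p.natDegree - 1 = i), p.natDegree = i + 1 := by
      intro p hp
      rw [Finset.mem_filter] at hp
      have := (hP p hp.1).2.natDegree_pos
      omega
    have hc := card_mul_le_of_natDegree_eq (hP.mono (Finset.filter_subset _ _)) hdeg
    have hc' : ((PP.filter (fun p => p.natDegree - 1 = i)).card : ℝ) * ((i : ℝ) + 1) ≤
        (Fintype.card K : ℝ) ^ (i + 1) := by exact_mod_cast hc
    rw [Finset.sum_congr rfl fun p hp => by rw [hdeg p hp], Finset.sum_const, nsmul_eq_mul,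
      ← div_eq_mul_inv, div_le_iff₀ (by positivity), inv_mul_eq_div, le_div_iff₀ (by positivity)]
    exact hc'
  have h3 := harmonic_le_one_add_log n
  have h4 : Real.exp (Real.log n) ≤ (n : ℝ) + 1 := by
    rcases Nat.eq_zero_or_pos n with rfl | hpos
    · simp
    · rw [Real.exp_log (by exact_mod_cast hpos)]
      linarith
  calc eulerZ PP ≤ Real.exp (2 + (Real.log n + Real.log n)) :=
        h1.trans (Real.exp_le_exp.2 (by linarith))
    _ = Real.exp 2 * Real.exp (Real.log n) ^ 2 := by rw [Real.exp_add, Real.exp_add]; ring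
    _ ≤ _ := by gcongr

theorem nrm_div_phi {PP : Finset K[X]} (hP : IsPrimeSet PP) {Q : K[X]}
    (hQ : Associated Q (∏ p ∈ PP, p)) : nrm Q / (phi Q : ℝ) = eulerZ PP := by
  have hq := q_pos (K := K)
  have hZ := zero_lt_one.trans_le (one_le_eulerZ hP)
  rw [phi_eq hP hQ, nrm_eq_pow (ne_zero_of_associated hP hQ), natDegree_of_associated hP hQ]
  field_simp

variable (K) in
/-- The bound for the fifth moment with an explicit power of `Z = |Q| / φ(Q)`. -/
theorem exists_abs_moment_five_le {ε : ℝ} (hε : 0 < ε) :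
    ∃ A : ℝ, 0 < A ∧ ∀ PP : Finset K[X], IsPrimeSet PP → ∀ Q : K[X],
      Associated Q (∏ p ∈ PP, p) → ∀ h : ℕ,
      |moment 5 Q h| ≤ A * (nrm Q * ((Fintype.card K : ℝ) ^ h) ^ 2 *
        ((Fintype.card K : ℝ) ^ h) ^ ε * eulerZ PP ^ 26) := by
  obtain ⟨A, hA, hb⟩ := exists_quintupleSum_le (K := K) hε
  refine ⟨A, hA, fun PP hP Q hQ h => ?_⟩
  have hq := q_pos (K := K)
  refine ((abs_moment_five_le hP hQ h).trans
    (mul_le_mul_of_nonneg_left (hb PP hP h) (by positivity))).trans (le_of_eq ?_)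
  rw [nrm_eq_pow (ne_zero_of_associated hP hQ), natDegree_of_associated hP hQ]
  field_simp

/-- Trading the factor `Z ^ 26 * H ^ (ε / 60)` for the two terms of the bound, according to whether
`Z` is at most `H ^ (ε / 60)`. -/
theorem rpow_mul_pow_le {H Z ε : ℝ} (hH : 1 ≤ H) (hZ : 1 ≤ Z) (hε : 0 < ε) :
    H ^ 2 * H ^ (ε / 60) * Z ^ 26 ≤ H ^ (2 + ε) * Z ^ (-4 : ℤ) + H ^ 2 * Z ^ 27 := by
  have hH0 : 0 < H := by linarith
  have hZ0 : 0 < Z := by linarith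
  rcases le_total Z (H ^ (ε / 60)) with hle | hle
  · refine le_trans ?_ (le_add_of_nonneg_right (by positivity))
    have h1 : H ^ (2 + ε) = H ^ 2 * H ^ ε := by
      rw [Real.rpow_add hH0, Real.rpow_two]
    have h2 : Z ^ (-4 : ℤ) = (Z ^ 4)⁻¹ := by
      rw [zpow_neg]
      rfl
    rw [h1, h2, ← div_eq_mul_inv, le_div_iff₀ (by positivity)]
    have h3 : Z ^ 30 ≤ H ^ (ε / 2) := by
      calc Z ^ 30 ≤ (H ^ (ε / 60)) ^ 30 := pow_le_pow_left₀ hZ0.le hle 30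
        _ = H ^ (ε / 2) := by
          rw [← Real.rpow_natCast, ← Real.rpow_mul hH0.le]
          congr 1
          push_cast
          ring
    have h4 : H ^ (ε / 60) * H ^ (ε / 2) ≤ H ^ ε := by
      rw [← Real.rpow_add hH0]
      exact Real.rpow_le_rpow_of_exponent_le hH (by linarith)
    calc H ^ 2 * H ^ (ε / 60) * Z ^ 26 * Z ^ 4 = H ^ 2 * (H ^ (ε / 60) * Z ^ 30) := by ring
      _ ≤ H ^ 2 * (H ^ (ε / 60) * H ^ (ε / 2)) := by gcongr
      _ ≤ H ^ 2 * H ^ ε := by gcongr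
  · refine le_trans ?_ (le_add_of_nonneg_left (by positivity))
    calc H ^ 2 * H ^ (ε / 60) * Z ^ 26 ≤ H ^ 2 * Z * Z ^ 26 := by gcongr
      _ = _ := by ring

variable (K) in
theorem exists_eulerZ_le {ε : ℝ} (hε : 0 < ε) :
    ∃ A : ℝ, 0 < A ∧ ∀ (h : ℕ) (PP : Finset K[X]), IsPrimeSet PP →
      (∀ p ∈ PP, p.natDegree ≤ 2 * h) → eulerZ PP ≤ A * ((Fintype.card K : ℝ) ^ h) ^ ε := by
  have hq := q_pos (K := K)
  obtain ⟨A, hA, hlog⟩ := exists_natCast_add_one_le (one_lt_q (K := K)) (half_pos hε)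
  refine ⟨Real.exp 2 * (4 * A ^ 2), by positivity, fun h PP hP hdeg => ?_⟩
  have h1 : ((Fintype.card K : ℝ) ^ h) ^ ε =
      ((Fintype.card K : ℝ) ^ h) ^ (ε / 2) * ((Fintype.card K : ℝ) ^ h) ^ (ε / 2) := by
    rw [← Real.rpow_add (by positivity), add_halves]
  have h2 := eulerZ_le hP hdeg
  push_cast at h2
  have h3 : 2 * (h : ℝ) + 1 ≤ 2 * (A * ((Fintype.card K : ℝ) ^ h) ^ (ε / 2)) := by
    have := hlog h
    linarith
  calc eulerZ PP ≤ Real.exp 2 * (2 * (h : ℝ) + 1) ^ 2 := h2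
    _ ≤ Real.exp 2 * (2 * (A * ((Fintype.card K : ℝ) ^ h) ^ (ε / 2))) ^ 2 := by gcongr
    _ = _ := by rw [h1]; ring

theorem mem_finite_irred {m : ℕ} {p : K[X]} :
    p ∈ (finite_irred (K := K) ((Fintype.card K : ℝ) ^ m)).toFinset ↔
      p.Monic ∧ Irreducible p ∧ p.natDegree ≤ m := by
  rw [Set.Finite.mem_toFinset, Set.mem_ofPred_eq]
  refine and_congr_right fun _ => and_congr_right fun hp => ?_
  rw [nrm_eq_pow hp.ne_zero, pow_le_pow_iff_right₀ one_lt_q]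

end FFMoment
end

theorem theorem1p4 (K : Type*) [Field K] [Fintype K] :
    (∀ ε : ℝ, 0 < ε → ∃ C : ℝ, 0 < C ∧ ∀ Q : Polynomial K, Squarefree Q → ∀ h : ℕ,
      |FFMoment.moment 5 Q h| ≤
        C * (FFMoment.nrm Q * ((Fintype.card K : ℝ) ^ h) ^ (2 + ε) *
              (FFMoment.nrm Q / (FFMoment.phi Q : ℝ)) ^ (-4 : ℤ) +
            FFMoment.nrm Q * (Fintype.card K : ℝ) ^ (2 * h) *
              (FFMoment.nrm Q / (FFMoment.phi Q : ℝ)) ^ 27)) ∧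
    (∀ ε : ℝ, 0 < ε → ∃ C : ℝ, 0 < C ∧ ∀ (h : ℕ) (Q : Polynomial K),
      Q = FFMoment.irredProduct K ((Fintype.card K : ℝ) ^ (2 * h)) →
      |FFMoment.moment 5 Q h| ≤
        C * (FFMoment.nrm Q * ((Fintype.card K : ℝ) ^ h) ^ (2 + ε))) := by
  have hq := FFMoment.q_pos (K := K)
  have hq1 := FFMoment.one_lt_q (K := K)
  refine ⟨fun ε hε => ?_, fun ε hε => ?_⟩
  · obtain ⟨A, hA, hb⟩ := FFMoment.exists_abs_moment_five_le K (ε := ε / 60) (by positivity)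
    refine ⟨A, hA, fun Q hQ h => ?_⟩
    obtain ⟨PP, hP, hass⟩ := FFMoment.exists_primeSet_of_squarefree hQ
    refine (hb PP hP Q hass h).trans (mul_le_mul_of_nonneg_left ?_ hA.le)
    rw [FFMoment.nrm_div_phi hP hass, mul_comm 2 h, pow_mul]
    have h1 := FFMoment.rpow_mul_pow_le (one_le_pow₀ hq1.le (n := h))
      (FFMoment.one_le_eulerZ hP) hε
    have hn : 0 ≤ FFMoment.nrm Q := by
      rw [FFMoment.nrm_eq_pow (FFMoment.ne_zero_of_associated hP hass)]
      positivity
    refine le_trans (le_of_eq ?_) ((mul_le_mul_of_nonneg_left h1 hn).trans (le_of_eq ?_)) <;> ring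
  · obtain ⟨A, hA, hb⟩ := FFMoment.exists_abs_moment_five_le K (ε := ε / 2) (by positivity)
    obtain ⟨B, hB, hm⟩ := FFMoment.exists_eulerZ_le K (ε := ε / 52) (by positivity)
    refine ⟨A * B ^ 26, by positivity, fun h Q hQ => ?_⟩
    set PP := (FFMoment.finite_irred (K := K) ((Fintype.card K : ℝ) ^ (2 * h))).toFinset with hPP
    have hP : FFMoment.IsPrimeSet PP := fun p hp =>
      ⟨(FFMoment.mem_finite_irred.1 hp).1, (FFMoment.mem_finite_irred.1 hp).2.1⟩
    have hass : Associated Q (∏ p ∈ PP, p) := by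
      rw [hQ, FFMoment.irredProduct]
    have hZ := hm h PP hP fun p hp => (FFMoment.mem_finite_irred.1 hp).2.2
    have hZ0 := zero_le_one.trans (FFMoment.one_le_eulerZ hP)
    have hn : 0 ≤ FFMoment.nrm Q := by
      rw [FFMoment.nrm_eq_pow (FFMoment.ne_zero_of_associated hP hass)]
      positivity
    refine (hb PP hP Q hass h).trans ?_
    have hH : 0 < (Fintype.card K : ℝ) ^ h := by positivity
    have h26 : (((Fintype.card K : ℝ) ^ h) ^ (ε / 52)) ^ 26 =
        ((Fintype.card K : ℝ) ^ h) ^ (ε / 2) := by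
      rw [← Real.rpow_natCast, ← Real.rpow_mul hH.le]
      congr 1
      push_cast
      ring
    have hsplit : ((Fintype.card K : ℝ) ^ h) ^ (2 + ε) = ((Fintype.card K : ℝ) ^ h) ^ 2 *
        ((Fintype.card K : ℝ) ^ h) ^ (ε / 2) * ((Fintype.card K : ℝ) ^ h) ^ (ε / 2) := by
      rw [mul_assoc, ← Real.rpow_add hH, add_halves, Real.rpow_add hH, Real.rpow_two]
    calc _ ≤ A * (FFMoment.nrm Q * ((Fintype.card K : ℝ) ^ h) ^ 2 *
          ((Fintype.card K : ℝ) ^ h) ^ (ε / 2) *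
          (B * ((Fintype.card K : ℝ) ^ h) ^ (ε / 52)) ^ 26) := by gcongr
      _ = _ := by rw [mul_pow, h26, hsplit]; ring
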